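/- \textbf{Setting.} Let $\Lambda$ be the complex Hilbert--Grassmann algebra with countably many anticommuting generators $\kappa_0,\kappa_1,\dots$: its elements are the series $\lambda=\sum_A c_A\kappa_A$ over finite sets $A=\{a_1<\dots<a_p\}\subset\mathbb N$, $\kappa_A=\kappa_{a_1}\cdots\kappa_{a_p}$, with $\|\lambda\|_\Lambda^2=\sum_A(|A|!)^{-2}|c_A|^2<\infty$. Let $\Lambda_{\bar0},\Lambda_{\bar1}$ be its even and odd parts, and $\lambda\mapsto\lambda^*$ the antilinear involution with $(\lambda\mu)^*=\mu^*\lambda^*$ and $\kappa_a^*=\kappa_a$. Let $\mathcal E_{\bar0},\mathcal E_{\bar1}$ be complex separable Hilbert spaces (given through orthonormal bases), $\mathcal H_{\bar k}=\mathcal E_{\bar k}\oplus\mathcal E_{\bar k}^*$ and $\mathcal H=\mathcal H_{\bar0}\oplus\mathcal H_{\bar1}$, with the antiunitary involution $f\mapsto f^*$ exchanging $\mathcal E_{\bar k}$ and $\mathcal E_{\bar k}^*$. Let $\mathcal S(\mathcal H)=\bigoplus_n\mathcal S_n(\mathcal H)$ be the Fock space (Hilbert sum), where $\mathcal S_n(\mathcal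 H)$ is the range in $\mathcal H^{\widehat\otimes n}$ of the projection $$P^{(n)}(f_1\otimes\cdots\otimes f_n)=\frac1{n!}\sum_\sigma\chi_\sigma(f_1,\dots,f_n)\,f_{\sigma(1)}\otimes\cdots\otimes f_{\sigma(n)},$$ $\chi_\sigma$ being the sign of the permutation induced on the fermionic factors (those in $\mathcal H_{\bar1}$), with product $F\odot G=\sqrt{(p+q)!/(p!\,q!)}\,P^{(p+q)}(F\otimes G)$ for $F,G$ of degrees $p,q$, and with the isometric antilinear involution satisfying $(F\odot G)^*=G^*\odot F^*$ and extending that of $\mathcal H$. Let $\mathcal S^\Lambda(\mathcal H)=\Lambda\widehat\otimes\mathcal S(\mathcal H)$ (Hilbert tensor product), with product $(\lambda\otimes F)(\mu\otimes G)=\lambda\mu\otimes(F\odot G)$ (where defined), involution $(\lambda\otimes F)^*=\lambda^*\otimes F^*$, and the forms $\langle\lambda\otimes F\mid\mu\otimes G\rangle=\lambda\mu\,(F^*\mid G)$ and $(\Xi\mid\mathrm H)=\langle\Xi^*\mid\mathrm H\rangle$, both with values in $\Lambda$. The superspace is $\mathcal H_\Lambda=(\Lambda_{\bar0}\widehat\otimes\mathcal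 H_{\bar0})\oplus(\Lambda_{\bar1}\widehat\otimes\mathcal H_{\bar1})$, and $\mathcal H_\Lambda^D=\{\zeta\in\mathcal H_\Lambda:\zeta^*=\zeta\}$. For $\zeta\in\mathcal H_\Lambda^D$ put $\exp\zeta=\sum_p\frac1{p!}\zeta^p$, and for $\Xi\in\mathcal S^\Lambda(\mathcal H)$ let $\varphi_\Xi(\zeta)=\langle\exp\zeta\mid\Xi\rangle$. Let $\mathcal F^\Lambda(\mathcal H_\Lambda^D)=\{\varphi_\Xi:\mathcal H_\Lambda^D\to\Lambda\mid\Xi\in\mathcal S^\Lambda(\mathcal H)\}$, with the form $(\varphi_\Xi\,\|\,\varphi_{\mathrm H}):=(\Xi\mid\mathrm H)$, and let $K(\zeta_1,\zeta_2)=(\exp\zeta_1\mid\exp\zeta_2)$. \textbf{Lemma.} One has $\exp\zeta\in\mathcal S^\Lambda(\mathcal H)$ for $\zeta\in\mathcal H_\Lambda^D$; the series defining the forms $\langle\cdot\mid\cdot\rangle$ and $(\cdot\mid\cdot)$ in an orthonormal basis converge in $\Lambda$ on $\mathcal S^\Lambda(\mathcal H)$; and $\Xi\mapsto\varphi_\Xi$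 is injective on $\mathcal S^\Lambda(\mathcal H)$, so that $(\cdot\,\|\,\cdot)$ is well defined. For all $\zeta_1,\zeta_2\in\mathcal H_\Lambda^D$, $$K(\zeta_1,\zeta_2)=(\exp\zeta_1\mid\exp\zeta_2)=e^{(\zeta_1\mid\zeta_2)}=e^{\langle\zeta_1\mid\zeta_2\rangle}\in\Lambda_{\bar0}.$$ For every $\eta\in\mathcal H_\Lambda^D$ the function $K(\cdot,\eta)$ belongs to $\mathcal F^\Lambda(\mathcal H_\Lambda^D)$, and every $\varphi\in\mathcal F^\Lambda(\mathcal H_\Lambda^D)$ satisfies $$(K(\cdot,\eta)\,\|\,\varphi)=\varphi(\eta).$$ Thus $\mathcal F^\Lambda(\mathcal H_\Lambda^D)$ is a $\Lambda$-valued reproducing kernel space with kernel $K$. -/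

import Mathlib

noncomputable section

namespace SuperFock

open scoped Nat

/-! ### The Hilbert-Grassmann algebra -/

/-- For disjoint finite sets `A`, `B` of labels of anticommuting generators this is the sign in
`κ_A κ_B = ± κ_{A ∪ B}`, where `κ_A = κ_{a₁} ⋯ κ_{aₙ}` for `A = {a₁ < ⋯ < aₙ}`. -/
def wedgeSign (A B : Finset ℕ) : ℂ :=
  (-1) ^ ((A ×ˢ B).filter fun p => p.2 < p.1).card

/-- The complex Hilbert-Grassmann algebra `Λ` with generators `κ₀, κ₁, κ₂, …`. An element is stored
through its coordinates in the orthonormal basis `|A|! κ_A` (`A` a finite set of labels), so that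
`‖λ‖² = ∑ₚ (p!)⁻² ‖λₚ‖ₚ²`, where `‖·‖ₚ` is the norm on the part of degree `p` in which the products
`κ_A`, `|A| = p`, are orthonormal. -/
def Grassmann : Type := lp (fun _ : Finset ℕ => ℂ) 2

instance : NormedAddCommGroup Grassmann :=
  inferInstanceAs (NormedAddCommGroup (lp (fun _ : Finset ℕ => ℂ) 2))

instance : InnerProductSpace ℂ Grassmann :=
  inferInstanceAs (InnerProductSpace ℂ (lp (fun _ : Finset ℕ => ℂ) 2))

instance : CompleteSpace Grassmann :=
  inferInstanceAs (CompleteSpace (lp (fun _ : Finset ℕ => ℂ) 2))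

namespace Grassmann

/-- The coefficient of `x` at the product `κ_A`: `x = ∑_A coeff x A • κ_A`. -/
def coeff (x : Grassmann) (A : Finset ℕ) : ℂ := (A.card ! : ℂ) * x.1 A

theorem ext_coeff {x y : Grassmann} (h : ∀ A, coeff x A = coeff y A) : x = y := by
  apply Subtype.ext
  funext A
  have h0 : (A.card ! : ℂ) ≠ 0 := by exact_mod_cast Nat.factorial_ne_zero _
  exact mul_left_cancel₀ h0 (h A)

/-- The family `c` of coefficients gives an element of finite norm. -/
def IsL2 (c : Finset ℕ → ℂ) : Prop :=
  Memℓp (fun A : Finset ℕ => c A / (A.card ! : ℂ)) 2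

/-- The element `∑_A c A • κ_A`. -/
def ofCoeff (c : Finset ℕ → ℂ) (hc : IsL2 c) : Grassmann :=
  ⟨fun A => c A / (A.card ! : ℂ), hc⟩

@[simp] theorem coeff_ofCoeff (c : Finset ℕ → ℂ) (hc : IsL2 c) (A : Finset ℕ) :
    coeff (ofCoeff c hc) A = c A := by
  have h0 : (A.card ! : ℂ) ≠ 0 := by exact_mod_cast Nat.factorial_ne_zero _
  exact mul_div_cancel₀ _ h0

@[simp] theorem coeff_add (x y : Grassmann) (A : Finset ℕ) :
    coeff (x + y) A = coeff x A + coeff y A := mul_add _ _ _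

@[simp] theorem coeff_smul (c : ℂ) (x : Grassmann) (A : Finset ℕ) :
    coeff (c • x) A = c * coeff x A := mul_left_comm _ _ _

@[simp] theorem coeff_zero (A : Finset ℕ) : coeff 0 A = 0 := mul_zero _

/-- Coefficients of the Grassmann product. -/
def mulCoeff (x y : Grassmann) (C : Finset ℕ) : ℂ :=
  ∑ A ∈ C.powerset, wedgeSign A (C \ A) * (coeff x A * coeff y (C \ A))

theorem le_choose {n p : ℕ} (h0 : 0 < p) (h1 : p < n) : n ≤ n.choose p := by
  induction n generalizing p with
  | zero => omega
  | succ n ih =>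
    obtain ⟨q, rfl⟩ : ∃ q, p = q + 1 := ⟨p - 1, by omega⟩
    rw [Nat.choose_succ_succ']
    have hq : 0 < n.choose q := Nat.choose_pos (by omega)
    rcases Nat.lt_or_ge (q + 1) n with h | h
    · have := ih (p := q + 1) (by omega) h
      omega
    · obtain rfl : n = q + 1 := by omega
      simp

theorem sum_inv_choose_le (n : ℕ) :
    ∑ p ∈ Finset.range (n + 1), ((n.choose p : ℝ))⁻¹ ≤ 4 := by
  have h : ∀ p ∈ Finset.range (n + 1), ((n.choose p : ℝ))⁻¹ ≤
      (if p = 0 then 1 else 0) + (if p = n then 1 else 0) + 2 * ((n : ℝ) + 1)⁻¹ := by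
    intro p hp
    have hp' : p ≤ n := by simpa [Nat.lt_succ_iff] using hp
    have hpos : (0 : ℝ) ≤ 2 * ((n : ℝ) + 1)⁻¹ := by positivity
    by_cases h0 : p = 0
    · subst h0
      simp only [Nat.choose_zero_right, Nat.cast_one, inv_one, if_true]
      split_ifs <;> linarith
    by_cases h1 : p = n
    · subst h1
      simp only [Nat.choose_self, Nat.cast_one, inv_one, if_true]
      split_ifs
      all_goals linarith
    have hc := le_choose (n := n) (p := p) (by omega) (by omega)
    have hn : (1 : ℝ) ≤ n := by exact_mod_cast (by omega : 1 ≤ n)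
    have hc' : (n : ℝ) ≤ n.choose p := by exact_mod_cast hc
    rw [if_neg h0, if_neg h1, zero_add, zero_add]
    calc ((n.choose p : ℝ))⁻¹ ≤ (n : ℝ)⁻¹ := by gcongr
      _ ≤ 2 * ((n : ℝ) + 1)⁻¹ := by
        rw [← div_eq_mul_inv, inv_eq_one_div, div_le_div_iff₀ (by linarith) (by linarith)]
        linarith
  refine (Finset.sum_le_sum h).trans ?_
  rw [Finset.sum_add_distrib, Finset.sum_add_distrib, Finset.sum_ite_eq', Finset.sum_ite_eq']
  simp only [Finset.sum_const, Finset.card_range, nsmul_eq_mul]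
  have : ((n + 1 : ℕ) : ℝ) * (2 * ((n : ℝ) + 1)⁻¹) = 2 := by
    push_cast
    field_simp
  rw [this]
  split_ifs <;> norm_num

theorem norm_wedgeSign (A B : Finset ℕ) : ‖wedgeSign A B‖ = 1 := by
  simp [wedgeSign]

theorem sq_mulCoeff_le (x y : Grassmann) (C : Finset ℕ) :
    ‖mulCoeff x y C / (C.card ! : ℂ)‖ ^ 2 ≤
      4 * ∑ A ∈ C.powerset, ‖x.1 A‖ ^ 2 * ‖y.1 (C \ A)‖ ^ 2 := by
  have h1 : ‖mulCoeff x y C / (C.card ! : ℂ)‖ ≤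
      ∑ A ∈ C.powerset, ((C.card.choose A.card : ℝ))⁻¹ * (‖x.1 A‖ * ‖y.1 (C \ A)‖) := by
    rw [mulCoeff, Finset.sum_div]
    refine (norm_sum_le _ _).trans (Finset.sum_le_sum fun A hA => ?_)
    have hAC : A ⊆ C := Finset.mem_powerset.1 hA
    have hle := Finset.card_le_card hAC
    rw [norm_div, norm_mul, norm_wedgeSign, one_mul, coeff, coeff, norm_mul, norm_mul, norm_mul,
      Finset.card_sdiff_of_subset hAC, Nat.cast_choose ℝ hle]
    simp only [Complex.norm_natCast]
    have ha : (C.card ! : ℝ) ≠ 0 := by exact_mod_cast Nat.factorial_ne_zero _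
    rw [inv_div]
    apply le_of_eq
    ring
  have h2 : ‖mulCoeff x y C / (C.card ! : ℂ)‖ ^ 2 ≤
      (∑ A ∈ C.powerset, ((C.card.choose A.card : ℝ))⁻¹ * (‖x.1 A‖ * ‖y.1 (C \ A)‖)) ^ 2 := by
    gcongr
  refine h2.trans ((Finset.sum_mul_sq_le_sq_mul_sq _ _ _).trans ?_)
  have h3 : ∑ A ∈ C.powerset, ((C.card.choose A.card : ℝ))⁻¹ ^ 2 ≤ 4 := by
    rw [Finset.sum_powerset_apply_card (fun p => ((C.card.choose p : ℝ))⁻¹ ^ 2)]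
    refine le_trans (Finset.sum_le_sum fun p hp => ?_) (sum_inv_choose_le C.card)
    have hp' : p ≤ C.card := by simpa [Nat.lt_succ_iff] using hp
    have : (C.card.choose p : ℝ) ≠ 0 := by exact_mod_cast (Nat.choose_pos hp').ne'
    rw [nsmul_eq_mul]
    apply le_of_eq
    field_simp
  simp only [mul_pow]
  gcongr

theorem summable_sq (x : Grassmann) : Summable fun A => ‖x.1 A‖ ^ 2 := by
  have := (memℓp_gen_iff (p := 2) (by norm_num)).1 x.2
  simpa using this

theorem norm_sq_eq (x : Grassmann) : ‖x‖ ^ 2 = ∑' A, ‖x.1 A‖ ^ 2 := by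
  have := lp.norm_rpow_eq_tsum (p := 2) (by norm_num) (show lp (fun _ : Finset ℕ => ℂ) 2 from x)
  have h2 : (2 : ENNReal).toReal = 2 := rfl
  simp only [h2, Real.rpow_ofNat] at this
  exact this

/-- Sums over pairs `A ⊆ C` of a product of two nonnegative summable families. -/
theorem summable_conv {u v : Finset ℕ → ℝ} (hu0 : ∀ A, 0 ≤ u A) (hv0 : ∀ A, 0 ≤ v A)
    (hu : Summable u) (hv : Summable v) :
    (Summable fun C : Finset ℕ => ∑ A ∈ C.powerset, u A * v (C \ A)) ∧
      ∑' C : Finset ℕ, ∑ A ∈ C.powerset, u A * v (C \ A) ≤ (∑' A, u A) * ∑' A, v A := by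
  have hprod : Summable fun p : Finset ℕ × Finset ℕ => u p.1 * v p.2 :=
    hu.mul_of_nonneg hv hu0 hv0
  let f : (Σ C : Finset ℕ, {A // A ∈ C.powerset}) → Finset ℕ × Finset ℕ :=
    fun s => (s.2.1, s.1 \ s.2.1)
  have hf : Function.Injective f := by
    rintro ⟨C, A, hA⟩ ⟨C', A', hA'⟩ h
    simp only [f, Prod.mk.injEq] at h
    obtain ⟨rfl, h2⟩ := h
    have e1 : A ∪ (C \ A) = C := Finset.union_sdiff_of_subset (Finset.mem_powerset.1 hA)
    have e2 : A ∪ (C' \ A) = C' := Finset.union_sdiff_of_subset (Finset.mem_powerset.1 hA')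
    obtain rfl : C = C' := by rw [← e1, h2, e2]
    rfl
  have hs := hprod.comp_injective hf
  have hinner : ∀ C : Finset ℕ, ∑' A : {A // A ∈ C.powerset}, u A.1 * v (C \ A.1) =
      ∑ A ∈ C.powerset, u A * v (C \ A) := by
    intro C
    rw [tsum_fintype, ← Finset.sum_coe_sort C.powerset]
  constructor
  · have := hs.sigma
    simp only [Function.comp_def, f, hinner] at this
    exact this
  · have h1 := hs.tsum_sigma
    simp only [Function.comp_def, f, hinner] at h1
    rw [← h1, hu.tsum_mul_tsum hv hprod]
    exact tsum_comp_le_tsum_of_inj hprod (fun p => mul_nonneg (hu0 _) (hv0 _)) hf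

theorem isL2_mulCoeff (x y : Grassmann) : IsL2 (mulCoeff x y) := by
  have h := (summable_conv (fun A => sq_nonneg ‖x.1 A‖) (fun A => sq_nonneg ‖y.1 A‖)
    (summable_sq x) (summable_sq y)).1
  refine (memℓp_gen_iff (p := 2) (by norm_num)).2 ?_
  simp only [ENNReal.toReal_ofNat, Real.rpow_ofNat]
  exact Summable.of_nonneg_of_le (fun _ => sq_nonneg _) (sq_mulCoeff_le x y) (h.mul_left 4)

instance : Mul Grassmann := ⟨fun x y => ofCoeff (mulCoeff x y) (isL2_mulCoeff x y)⟩

theorem coeff_mul (x y : Grassmann) (C : Finset ℕ) :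
    coeff (x * y) C =
      ∑ A ∈ C.powerset, wedgeSign A (C \ A) * (coeff x A * coeff y (C \ A)) :=
  coeff_ofCoeff _ _ _

theorem norm_mul_le' (x y : Grassmann) : ‖x * y‖ ≤ 2 * ‖x‖ * ‖y‖ := by
  have h := summable_conv (fun A => sq_nonneg ‖x.1 A‖) (fun A => sq_nonneg ‖y.1 A‖)
    (summable_sq x) (summable_sq y)
  have h1 : ‖x * y‖ ^ 2 ≤ (2 * ‖x‖ * ‖y‖) ^ 2 := by
    rw [norm_sq_eq]
    refine (Summable.tsum_le_tsum (sq_mulCoeff_le x y) (summable_sq (x * y))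
      (h.1.mul_left 4)).trans ?_
    rw [tsum_mul_left, mul_pow, mul_pow, norm_sq_eq x, norm_sq_eq y]
    have := h.2
    nlinarith
  exact le_of_sq_le_sq h1 (by positivity)

theorem isL2_single (B : Finset ℕ) : IsL2 (fun A => if A = B then 1 else 0) := by
  refine (memℓp_gen_iff (p := 2) (by norm_num)).2 ?_
  refine summable_of_ne_finset_zero (s := {B}) fun A hA => ?_
  have : A ≠ B := by simpa using hA
  simp [this]

/-- The basis product `κ_B`. -/
def kappa (B : Finset ℕ) : Grassmann := ofCoeff (fun A => if A = B then 1 else 0) (isL2_single B)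

instance : One Grassmann := ⟨kappa ∅⟩

theorem coeff_one (A : Finset ℕ) : coeff 1 A = if A = ∅ then 1 else 0 := coeff_ofCoeff _ _ _

theorem wedgeSign_empty_left (B : Finset ℕ) : wedgeSign ∅ B = 1 := by simp [wedgeSign]

theorem wedgeSign_empty_right (A : Finset ℕ) : wedgeSign A ∅ = 1 := by simp [wedgeSign]

theorem wedgeSign_union_left {A B : Finset ℕ} (h : Disjoint A B) (C : Finset ℕ) :
    wedgeSign (A ∪ B) C = wedgeSign A C * wedgeSign B C := by
  rw [wedgeSign, wedgeSign, wedgeSign, ← pow_add, Finset.union_product, Finset.filter_union,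
    Finset.card_union_of_disjoint]
  exact Finset.disjoint_filter_filter (Finset.disjoint_product.2 (Or.inl h))

theorem wedgeSign_union_right {B C : Finset ℕ} (h : Disjoint B C) (A : Finset ℕ) :
    wedgeSign A (B ∪ C) = wedgeSign A B * wedgeSign A C := by
  rw [wedgeSign, wedgeSign, wedgeSign, ← pow_add, Finset.product_union, Finset.filter_union,
    Finset.card_union_of_disjoint]
  exact Finset.disjoint_filter_filter (Finset.disjoint_product.2 (Or.inr h))

protected theorem one_mul' (x : Grassmann) : 1 * x = x := by
  refine ext_coeff fun C => ?_
  rw [coeff_mul, Finset.sum_eq_single_of_mem ∅ (Finset.empty_mem_powerset C)]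
  · simp [coeff_one, wedgeSign_empty_left]
  · intro A _ hA
    simp [coeff_one, hA]

protected theorem mul_one' (x : Grassmann) : x * 1 = x := by
  refine ext_coeff fun C => ?_
  rw [coeff_mul, Finset.sum_eq_single_of_mem C (Finset.mem_powerset_self C)]
  · simp [coeff_one, wedgeSign_empty_right]
  · intro A hA hne
    have : C \ A ≠ ∅ := fun h =>
      hne ((Finset.mem_powerset.1 hA).antisymm (Finset.sdiff_eq_empty_iff_subset.1 h))
    simp [coeff_one, this]

protected theorem mul_assoc' (x y z : Grassmann) : x * y * z = x * (y * z) := by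
  refine ext_coeff fun D => ?_
  rw [coeff_mul, coeff_mul]
  simp only [coeff_mul, Finset.mul_sum, Finset.sum_mul]
  rw [Finset.sum_sigma', Finset.sum_sigma']
  refine Finset.sum_bij' (fun s _ => ⟨s.2, s.1 \ s.2⟩) (fun s _ => ⟨s.1 ∪ s.2, s.1⟩) ?_ ?_ ?_ ?_ ?_
  · rintro ⟨C, A⟩ h
    simp only [Finset.mem_sigma, Finset.mem_powerset] at h ⊢
    exact ⟨h.2.trans h.1, Finset.sdiff_subset_sdiff h.1 subset_rfl⟩
  · rintro ⟨A, B⟩ h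
    simp only [Finset.mem_sigma, Finset.mem_powerset] at h ⊢
    exact ⟨Finset.union_subset h.1 (h.2.trans Finset.sdiff_subset), Finset.subset_union_left⟩
  · rintro ⟨C, A⟩ h
    simp only [Finset.mem_sigma, Finset.mem_powerset] at h
    simp only [Finset.union_sdiff_of_subset h.2]
  · rintro ⟨A, B⟩ h
    simp only [Finset.mem_sigma, Finset.mem_powerset] at h
    have hd : Disjoint A B := (Finset.disjoint_sdiff (s := A) (t := D)).mono_right h.2
    simp only [Finset.union_sdiff_cancel_left hd]
  · rintro ⟨C, A⟩ h
    simp only [Finset.mem_sigma, Finset.mem_powerset] at h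
    obtain ⟨hC, hA⟩ := h
    dsimp only at hC hA ⊢
    have e1 : (D \ A) \ (C \ A) = D \ C := by
      ext a
      have := @hA a
      simp only [Finset.mem_sdiff]
      tauto
    have e2 : D \ A = (C \ A) ∪ (D \ C) := by
      ext a
      have := @hA a
      have := @hC a
      simp only [Finset.mem_sdiff, Finset.mem_union]
      tauto
    have d1 : Disjoint A (C \ A) := Finset.disjoint_sdiff
    have d2 : Disjoint (C \ A) (D \ C) :=
      (Finset.disjoint_sdiff (s := C) (t := D)).mono_left Finset.sdiff_subset
    have s1 : wedgeSign C (D \ C) = wedgeSign A (D \ C) * wedgeSign (C \ A) (D \ C) := by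
      rw [← wedgeSign_union_left d1, Finset.union_sdiff_of_subset hA]
    have s2 : wedgeSign A (D \ A) = wedgeSign A (C \ A) * wedgeSign A (D \ C) := by
      rw [e2, wedgeSign_union_right d2]
    rw [e1, s1, s2]
    ring

instance : Ring Grassmann :=
  { (inferInstance : AddCommGroup Grassmann) with
    mul := (· * ·)
    one := 1
    mul_assoc := Grassmann.mul_assoc'
    one_mul := Grassmann.one_mul'
    mul_one := Grassmann.mul_one'
    left_distrib := fun x y z => ext_coeff fun C => by
      rw [coeff_add]
      simp only [coeff_mul, coeff_add, mul_add, Finset.sum_add_distrib]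
    right_distrib := fun x y z => ext_coeff fun C => by
      rw [coeff_add]
      simp only [coeff_mul, coeff_add, add_mul, mul_add, Finset.sum_add_distrib]
    zero_mul := fun x => ext_coeff fun C => by
      simp only [coeff_mul, coeff_zero, zero_mul, mul_zero, Finset.sum_const_zero]
    mul_zero := fun x => ext_coeff fun C => by
      simp only [coeff_mul, coeff_zero, mul_zero, Finset.sum_const_zero] }

protected theorem smul_mul' (c : ℂ) (x y : Grassmann) : c • x * y = c • (x * y) :=
  ext_coeff fun C => by
    rw [coeff_smul]
    simp only [coeff_mul, coeff_smul, Finset.mul_sum]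
    exact Finset.sum_congr rfl fun A _ => by ring

protected theorem mul_smul' (c : ℂ) (x y : Grassmann) : x * c • y = c • (x * y) :=
  ext_coeff fun C => by
    rw [coeff_smul]
    simp only [coeff_mul, coeff_smul, Finset.mul_sum]
    exact Finset.sum_congr rfl fun A _ => by ring

instance : Algebra ℂ Grassmann := Algebra.ofModule Grassmann.smul_mul' Grassmann.mul_smul'

instance : IsTopologicalRing Grassmann where
  continuous_mul := by
    have h : IsBoundedBilinearMap ℂ fun p : Grassmann × Grassmann => p.1 * p.2 :=
      { add_left := fun x y z => add_mul x y z
        smul_left := Grassmann.smul_mul'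
        add_right := fun x y z => mul_add x y z
        smul_right := fun c x y => Grassmann.mul_smul' c x y
        bound := ⟨2, by norm_num, norm_mul_le'⟩ }
    exact h.continuous

/-- Coefficients of the involution: `(λ μ)* = μ* λ*`, antilinear, `κ_a* = κ_a`. Hence
`(κ_A)*` is the product of the generators in reversed order, `(-1)^{|A|(|A|-1)/2} κ_A`. -/
def starCoeff (x : Grassmann) (A : Finset ℕ) : ℂ :=
  (-1) ^ (A.card * (A.card - 1) / 2) * (starRingEnd ℂ) (coeff x A)

theorem isL2_starCoeff (x : Grassmann) : IsL2 (starCoeff x) := by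
  refine (memℓp_gen_iff (p := 2) (by norm_num)).2 ?_
  simp only [ENNReal.toReal_ofNat, Real.rpow_ofNat]
  refine (summable_sq x).congr fun A => ?_
  have h0 : (A.card ! : ℝ) ≠ 0 := by exact_mod_cast Nat.factorial_ne_zero _
  simp [starCoeff, coeff, h0]

/-- The parity preserving isometric involution of `Λ`. -/
instance : Star Grassmann := ⟨fun x => ofCoeff (starCoeff x) (isL2_starCoeff x)⟩

/-- The subspaces `Λ_0̄` and `Λ_1̄` spanned by the products `κ_A` with `|A|` even, resp. odd. -/
def part (k : ZMod 2) : Submodule ℂ Grassmann where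
  carrier := {x | ∀ A : Finset ℕ, (A.card : ZMod 2) ≠ k → coeff x A = 0}
  add_mem' := fun {x y} hx hy A hA => by rw [coeff_add, hx A hA, hy A hA, add_zero]
  zero_mem' := fun A _ => coeff_zero A
  smul_mem' := fun c x hx A hA => by rw [coeff_smul, hx A hA, mul_zero]

end Grassmann

/-! ### The one-particle space

The particle spaces are complex separable Hilbert spaces `E_0̄` (bosons) and `E_1̄` (fermions) with
orthonormal bases indexed by the countable types `ι₀` and `ι₁`. The one-particle space is
`H = E_0̄ ⊕ E_0̄* ⊕ E_1̄ ⊕ E_1̄*` with the orthonormal basis `e_i`, `e_i*`.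

If a Hilbert space `K` has an orthonormal basis `(e_i)`, `i ∈ I`, then every element of the completed
tensor product `Λ ⊗̂ K` has a unique expansion `∑ i, λ_i ⊗ e_i` with `λ_i ∈ Λ`, and its norm is given
by `∑ i, ‖λ_i‖²`. Elements of such spaces are represented by their families `i ↦ λ_i`. -/

/-- Labels of the orthonormal basis of `H`: the first component is a basis label of `E_0̄` or of
`E_1̄`; the second one is `false` for the vector `e_i` and `true` for its conjugate `e_i*`. -/
abbrev Idx (ι₀ ι₁ : Type*) := (ι₀ ⊕ ι₁) × Bool

/-- Parity of a basis vector: `0` on `H_0̄` (bosonic), `1` on `H_1̄` (fermionic). -/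
def parity {ι₀ ι₁ : Type*} (i : Idx ι₀ ι₁) : ZMod 2 := Sum.elim (fun _ => 0) (fun _ => 1) i.1

/-- The antiunitary involution `f ↦ f*` of `H` on the basis: it exchanges `e_i` and `e_i*`. -/
def conjIdx {ι₀ ι₁ : Type*} (i : Idx ι₀ ι₁) : Idx ι₀ ι₁ := (i.1, !i.2)

/-- The involution of `Λ ⊗̂ H`, `(λ ⊗ f)* = λ* ⊗ f*`. -/
def vecStar {ι₀ ι₁ : Type*} (ζ : Idx ι₀ ι₁ → Grassmann) : Idx ι₀ ι₁ → Grassmann :=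
  fun i => star (ζ (conjIdx i))

/-- The superspace `H_Λ = (Λ_0̄ ⊗̂ H_0̄) ⊕ (Λ_1̄ ⊗̂ H_1̄) ⊆ Λ ⊗̂ H`; the point
`ζ = ∑ i, λ_i ⊗ e_i` is given by the square summable family `λ_i`. -/
def Superspace (ι₀ ι₁ : Type*) : Set (Idx ι₀ ι₁ → Grassmann) :=
  {ζ | Memℓp ζ 2 ∧ ∀ i, ζ i ∈ Grassmann.part (parity i)}

/-- The real diagonal subspace `H_Λ^D = {ζ ∈ H_Λ | ζ* = ζ}`. -/
def DiagSuperspace (ι₀ ι₁ : Type*) : Set (Idx ι₀ ι₁ → Grassmann) :=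
  {ζ | ζ ∈ Superspace ι₀ ι₁ ∧ vecStar ζ = ζ}

/-- The `Λ`-bilinear form on `Λ ⊗̂ H` with `⟨λ ⊗ f | μ ⊗ g⟩ = λ μ (f* | g)`. -/
def vecPairing {ι₀ ι₁ : Type*} (ζ η : Idx ι₀ ι₁ → Grassmann) : Grassmann :=
  ∑' i, ζ (conjIdx i) * η i

/-- The `Λ`-sesquilinear form `(ζ | η) = ⟨ζ* | η⟩` on `Λ ⊗̂ H`. -/
def vecSesq {ι₀ ι₁ : Type*} (ζ η : Idx ι₀ ι₁ → Grassmann) : Grassmann :=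
  vecPairing (vecStar ζ) η

/-! ### The Fock space -/

/-- Families of coefficients of (formal) elements `∑ₙ ∑_a Ξₙ(a) ⊗ (e_{a₁} ⊗ ⋯ ⊗ e_{aₙ})` of
`Λ ⊗̂ T(H)`, where `T(H)` is the full tensor space. -/
abbrev TensorFamily (ι₀ ι₁ : Type*) := (n : ℕ) → (Fin n → Idx ι₀ ι₁) → Grassmann

/-- The sign `χ_σ(f₁, …, fₙ)` for `f_k = e_{a k}`: the parity of the number of inversions of the
fermionic vectors in the sequence `f_{σ(1)}, …, f_{σ(n)}`. -/
def gradedSign {ι₀ ι₁ : Type*} {n : ℕ} (σ : Equiv.Perm (Fin n)) (a : Fin n → Idx ι₀ ι₁) : ℂ :=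
  (-1) ^ (Finset.univ.filter fun p : Fin n × Fin n =>
    p.1 < p.2 ∧ σ p.2 < σ p.1 ∧ parity (a (σ p.1)) = 1 ∧ parity (a (σ p.2)) = 1).card

/-- The projection `P⁽ⁿ⁾`, given on basis tensors by
`f₁ ⊗ ⋯ ⊗ fₙ ↦ (n!)⁻¹ ∑_σ χ_σ(f₁, …, fₙ) f_{σ(1)} ⊗ ⋯ ⊗ f_{σ(n)}`, written for the coefficients: the
tensor `f_{σ(1)} ⊗ ⋯ ⊗ f_{σ(n)}` has the label `b` if `f₁ ⊗ ⋯ ⊗ fₙ` has the label `b ∘ σ⁻¹`. -/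
def gradedProj {ι₀ ι₁ : Type*} {n : ℕ} (F : (Fin n → Idx ι₀ ι₁) → Grassmann) :
    (Fin n → Idx ι₀ ι₁) → Grassmann :=
  fun b => (n ! : ℂ)⁻¹ • ∑ σ : Equiv.Perm (Fin n), gradedSign σ (b ∘ ⇑σ⁻¹) • F (b ∘ ⇑σ⁻¹)

/-- The product `(λ ⊗ F) · (μ ⊗ G) = λ μ ⊗ (F ⊙ G)` of homogeneous elements of degrees `p` and `q`,
where `F ⊙ G = √((p+q)! / (p! q!)) P⁽ᵖ⁺q⁾ (F ⊗ G)`. -/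
def gradedMul {ι₀ ι₁ : Type*} {p q : ℕ} (F : (Fin p → Idx ι₀ ι₁) → Grassmann)
    (G : (Fin q → Idx ι₀ ι₁) → Grassmann) : (Fin (p + q) → Idx ι₀ ι₁) → Grassmann :=
  ((Real.sqrt (((p + q)! : ℝ) / (p ! * q !)) : ℝ) : ℂ) •
    gradedProj fun a => F (fun k => a (Fin.castAdd q k)) * G (fun k => a (Fin.natAdd p k))

/-- The `Λ`-extended Fock space `S^Λ(H) = Λ ⊗̂ S(H)`, `S(H) = ⨁ₙ Sₙ(H)`: families of finite norm,
`‖Ξ‖² = ∑ₙ ∑_a ‖Ξₙ(a)‖²`, whose components are in the range of `P⁽ⁿ⁾`. -/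
def FockSpace (ι₀ ι₁ : Type*) : Set (TensorFamily ι₀ ι₁) :=
  {Ξ | Memℓp (fun s : (Σ n, (Fin n → Idx ι₀ ι₁)) => Ξ s.1 s.2) 2 ∧ ∀ n, gradedProj (Ξ n) = Ξ n}

/-- The involution of `S^Λ(H)`: `(λ ⊗ F)* = λ* ⊗ F*` with the antilinear involution
`(f₁ ⊗ ⋯ ⊗ fₙ)* = fₙ* ⊗ ⋯ ⊗ f₁*`, for which `(F ⊙ G)* = G* ⊙ F*`. -/
def fockStar {ι₀ ι₁ : Type*} (Ξ : TensorFamily ι₀ ι₁) : TensorFamily ι₀ ι₁ :=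
  fun _ a => star (Ξ _ fun k => conjIdx (a k.rev))

/-- The terms of the series `⟨Ξ | Η⟩`: in the pairing `⟨F | G⟩ = (F* | G)` the basis tensor
`e_{a₁} ⊗ ⋯ ⊗ e_{aₙ}` is dual to `e_{aₙ}* ⊗ ⋯ ⊗ e_{a₁}*`. -/
def pairingTerm {ι₀ ι₁ : Type*} (Ξ Η : TensorFamily ι₀ ι₁) (s : Σ n, (Fin n → Idx ι₀ ι₁)) :
    Grassmann :=
  Ξ s.1 (fun k => conjIdx (s.2 k.rev)) * Η s.1 s.2

/-- The `Λ`-bilinear form `⟨λ ⊗ F | μ ⊗ G⟩ = λ μ ⟨F | G⟩`. -/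
def pairing {ι₀ ι₁ : Type*} (Ξ Η : TensorFamily ι₀ ι₁) : Grassmann := ∑' s, pairingTerm Ξ Η s

/-- The `Λ`-sesquilinear form `(Ξ | Η) = ⟨Ξ* | Η⟩`. -/
def sesq {ι₀ ι₁ : Type*} (Ξ Η : TensorFamily ι₀ ι₁) : Grassmann := pairing (fockStar Ξ) Η

/-! ### Coherent states and the function space -/

/-- The powers `ζᵖ` with respect to the product of `S_fin^Λ(H)`. -/
def vecPow {ι₀ ι₁ : Type*} (ζ : Idx ι₀ ι₁ → Grassmann) : TensorFamily ι₀ ι₁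
  | 0 => fun _ => 1
  | p + 1 => gradedMul (vecPow ζ p) fun a : Fin 1 → Idx ι₀ ι₁ => ζ (a 0)

/-- The coherent state `exp ζ = ∑ₚ (p!)⁻¹ ζᵖ`; its component of degree `p` is `(p!)⁻¹ ζᵖ`. -/
def coherent {ι₀ ι₁ : Type*} (ζ : Idx ι₀ ι₁ → Grassmann) : TensorFamily ι₀ ι₁ :=
  fun p a => (p ! : ℂ)⁻¹ • vecPow ζ p a

/-- The function `φ_Ξ(ζ) = ⟨exp ζ | Ξ⟩` on `H_Λ^D`. -/
def phi {ι₀ ι₁ : Type*} (Ξ : TensorFamily ι₀ ι₁) : DiagSuperspace ι₀ ι₁ → Grassmann :=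
  fun ζ => pairing (coherent ζ.1) Ξ

/-- The function space `F^Λ(H_Λ^D) = {φ_Ξ | Ξ ∈ S^Λ(H)}`. -/
def FunSpace (ι₀ ι₁ : Type*) : Set (DiagSuperspace ι₀ ι₁ → Grassmann) :=
  phi '' FockSpace ι₀ ι₁

/-- A tensor `Ξ ∈ S^Λ(H)` with `f = φ_Ξ`, for `f ∈ F^Λ(H_Λ^D)`. -/
def symbol {ι₀ ι₁ : Type*} (f : DiagSuperspace ι₀ ι₁ → Grassmann) : TensorFamily ι₀ ι₁ :=
  Function.invFunOn phi (FockSpace ι₀ ι₁) f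

/-- The form `(φ_Ξ ‖ φ_Η) = (Ξ | Η)` on `F^Λ(H_Λ^D)`. -/
def form {ι₀ ι₁ : Type*} (f g : DiagSuperspace ι₀ ι₁ → Grassmann) : Grassmann :=
  sesq (symbol f) (symbol g)

/-- The kernel `K(ζ₁, ζ₂) = (exp ζ₁ | exp ζ₂)`. -/
def kernel {ι₀ ι₁ : Type*} (ζ₁ ζ₂ : DiagSuperspace ι₀ ι₁) : Grassmann :=
  sesq (coherent ζ₁.1) (coherent ζ₂.1)

end SuperFock

end

/-! The component `ζ i` of a point of the superspace has the parity of the basis vector `e_i`.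
Products of components therefore reorder with exactly the sign used by `gradedProj`, so the tensor
powers of `ζ` are already graded symmetric. The square roots in `gradedMul` telescope, and `coherent
ζ` has the coefficient `ζ_{a₁} ⋯ ζ_{aₚ} / √p!` (`vecPow_eq`, `coherent_apply`). The factor `1 / p!`
in the squared norm beats the geometric growth of the rest (`coherent_mem_fockSpace`).

In the pairing of two coherent states the left factor carries reversed labels, so the products are
nested. The innermost pair `ζ_{i*} η_i` is even, hence central, and can be extracted; degree `p`
then contributes `⟨ζ | η⟩ᵖ / p!` (`ordProd_dualIdx_mul`, `kernel_eq_exp`). On real points the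
involution fixes `exp ζ`, so `K(·, η)` is `φ` of `exp η` (`kernel_eq_phi`) and the reproducing
formula only unfolds definitions, provided that the form is well defined.

That proviso, injectivity of `Ξ ↦ φ_Ξ`, is the hard part (`eq_zero_of_phi_eq_zero`). If `φ_Ξ = 0`,
scaling by real `t` isolates the homogeneous components, polarization symmetrizes them, and complex
multilinearity removes the reality condition. Test vectors are then built from monomials in
generators absent from a given `κ_A`: by graded symmetry of `Ξ` all permutations contribute the same
term, and multiplication by such monomials cannot kill the coefficient at `κ_A`. Since `A` is
finite, unused generators always exist. -/

noncomputable section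

namespace SuperFock

open scoped Nat

/-! ### Reordering products of supercommuting elements -/

/-- The sign of the permutation induced by `σ` on the positions `k` with `o k = 1`. -/
def permSign {n : ℕ} (o : Fin n → ZMod 2) (σ : Equiv.Perm (Fin n)) : ℂ :=
  (-1) ^ (Finset.univ.filter fun p : Fin n × Fin n =>
    p.1 < p.2 ∧ σ p.2 < σ p.1 ∧ o p.1 = 1 ∧ o p.2 = 1).card

theorem permSign_one {n : ℕ} (o : Fin n → ZMod 2) : permSign o 1 = 1 := by
  rw [permSign, Finset.filter_false_of_mem, Finset.card_empty, pow_zero]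
  rintro ⟨p, q⟩ - ⟨h1, h2, -⟩
  exact absurd h1 (not_lt.2 h2.le)

theorem permSign_mul_self {n : ℕ} (o : Fin n → ZMod 2) (σ : Equiv.Perm (Fin n)) :
    permSign o σ * permSign o σ = 1 := by
  rw [permSign, ← mul_pow]
  simp

theorem permSign_eq_prod {n : ℕ} (o : Fin n → ZMod 2) (σ : Equiv.Perm (Fin n)) :
    permSign o σ = ∏ p : Fin n × Fin n,
      if p.1 < p.2 ∧ σ p.2 < σ p.1 ∧ o p.1 = 1 ∧ o p.2 = 1 then -1 else 1 := by
  rw [Finset.prod_ite, Finset.prod_const, Finset.prod_const_one, mul_one, permSign]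

/-- The `σ⁻¹` in the labels cancels the `σ` in the parity conditions, which leaves the parities at
the original positions. -/
theorem gradedSign_comp_inv {ι₀ ι₁ : Type*} {n : ℕ} (σ : Equiv.Perm (Fin n))
    (b : Fin n → Idx ι₀ ι₁) :
    gradedSign σ (b ∘ ⇑σ⁻¹) = permSign (fun k => parity (b k)) σ := by
  simp [gradedSign, permSign]

theorem swap_adjacent_lt_iff {n : ℕ} (i : Fin n) {u v : Fin (n + 1)}
    (h : ¬(u = i.castSucc ∧ v = i.succ)) (h' : ¬(u = i.succ ∧ v = i.castSucc)) :
    Equiv.swap i.castSucc i.succ u < Equiv.swap i.castSucc i.succ v ↔ u < v := by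
  rw [Equiv.swap_apply_def, Equiv.swap_apply_def]
  simp only [Fin.ext_iff, Fin.lt_def, apply_ite Fin.val, Fin.val_castSucc, Fin.val_succ] at h h' ⊢
  split_ifs <;> omega

/-- Exchanging two neighbouring values changes the inversion status of a single pair of positions,
the preimages of these values; it matters only if both are fermionic. -/
theorem permSign_swap_mul {n : ℕ} (o : Fin (n + 1) → ZMod 2) (σ : Equiv.Perm (Fin (n + 1)))
    (i : Fin n) :
    permSign o (Equiv.swap i.castSucc i.succ * σ) =
      (if o (σ⁻¹ i.castSucc) = 1 ∧ o (σ⁻¹ i.succ) = 1 then -1 else 1) * permSign o σ := by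
  set P := σ⁻¹ i.castSucc with hP
  set Q := σ⁻¹ i.succ with hQ
  have eP : σ P = i.castSucc := by simp [hP]
  have eQ : σ Q = i.succ := by simp [hQ]
  have hPQ : P ≠ Q := fun h => by
    have := congrArg σ h
    rw [eP, eQ] at this
    exact absurd this (Fin.castSucc_lt_succ).ne
  have hlt : i.castSucc < i.succ := Fin.castSucc_lt_succ
  -- Inversions are counted over increasing pairs, so the exceptional pair has to be sorted.
  let e : Fin (n + 1) × Fin (n + 1) := (min P Q, max P Q)
  have key : ∀ p : Fin (n + 1) × Fin (n + 1),
      (if p.1 < p.2 ∧ (Equiv.swap i.castSucc i.succ * σ) p.2 <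
        (Equiv.swap i.castSucc i.succ * σ) p.1 ∧ o p.1 = 1 ∧ o p.2 = 1 then (-1 : ℂ) else 1) =
      (if p = e then (if o P = 1 ∧ o Q = 1 then -1 else 1) else 1) *
        if p.1 < p.2 ∧ σ p.2 < σ p.1 ∧ o p.1 = 1 ∧ o p.2 = 1 then -1 else 1 := by
    rintro ⟨p, q⟩
    simp only [Equiv.Perm.mul_apply, e, Prod.mk.injEq]
    by_cases hpq : p < q
    · by_cases h1 : p = P ∧ q = Q
      · obtain ⟨rfl, rfl⟩ := h1
        simp [min_eq_left hpq.le, max_eq_right hpq.le, eP, eQ, hpq, hlt, hlt.not_gt]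
      by_cases h2 : p = Q ∧ q = P
      · obtain ⟨rfl, rfl⟩ := h2
        simp only [min_eq_right hpq.le, max_eq_left hpq.le, eP, eQ, Equiv.swap_apply_left,
          Equiv.swap_apply_right, hpq, hlt, hlt.not_gt, true_and, false_and, and_self, if_true,
          if_false]
        by_cases hP1 : o P = 1 <;> by_cases hQ1 : o Q = 1 <;> simp [hP1, hQ1]
      · have hne : ¬(p = min P Q ∧ q = max P Q) := by
          rintro ⟨rfl, rfl⟩
          rcases le_total P Q with h | h
          · exact h1 ⟨min_eq_left h, max_eq_right h⟩
          · exact h2 ⟨min_eq_right h, max_eq_left h⟩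
        have hs := swap_adjacent_lt_iff i (u := σ q) (v := σ p)
          (fun h => h2 ⟨by simp [hQ, ← h.2], by simp [hP, ← h.1]⟩)
          (fun h => h1 ⟨by simp [hP, ← h.2], by simp [hQ, ← h.1]⟩)
        rw [if_neg hne, one_mul]
        simp only [hs]
    · have hne : ¬(p = min P Q ∧ q = max P Q) := by
        rintro ⟨rfl, rfl⟩
        exact hpq (min_lt_max.2 hPQ)
      simp [hpq, hne]
  rw [permSign_eq_prod, permSign_eq_prod, Finset.prod_congr rfl fun p _ => key p,
    Finset.prod_mul_distrib, Finset.prod_ite_eq' Finset.univ e, if_pos (Finset.mem_univ _)]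

theorem prod_ofFn_swap_adjacent {R : Type*} [Ring R] [Algebra ℂ R] {n : ℕ} (y : Fin (n + 1) → R)
    (i : Fin n) {c : ℂ} (h : y i.succ * y i.castSucc = c • (y i.castSucc * y i.succ)) :
    (List.ofFn (y ∘ Equiv.swap i.castSucc i.succ)).prod = c • (List.ofFn y).prod := by
  induction n with
  | zero => exact i.elim0
  | succ n ih =>
    refine Fin.cases (fun h => ?_) (fun j h => ?_) i h
    · have hs : ∀ k : Fin n, Equiv.swap (0 : Fin (n + 2)) 1 k.succ.succ = k.succ.succ := fun k =>
        Equiv.swap_apply_of_ne_of_ne (Fin.succ_ne_zero _)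
          (fun h => Fin.succ_ne_zero k (Fin.succ_injective _ h))
      simp only [Fin.castSucc_zero, Fin.succ_zero_eq_one] at h ⊢
      simp only [List.ofFn_succ, List.prod_cons, Function.comp_apply, Fin.succ_zero_eq_one,
        Equiv.swap_apply_left, Equiv.swap_apply_right, hs]
      rw [← mul_assoc, h, smul_mul_assoc, mul_assoc]
    · have hs : ∀ k : Fin (n + 1), Equiv.swap j.succ.castSucc j.succ.succ k.succ =
          (Equiv.swap j.castSucc j.succ k).succ := fun k => by
        rw [← Fin.succ_castSucc]
        exact ((Fin.succ_injective _).map_swap _ _ _).symm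
      have h0 : Equiv.swap j.succ.castSucc j.succ.succ 0 = 0 :=
        Equiv.swap_apply_of_ne_of_ne (by rw [← Fin.succ_castSucc]; exact (Fin.succ_ne_zero _).symm)
          (Fin.succ_ne_zero _).symm
      have := ih (fun k => y k.succ) j (by simpa [← Fin.succ_castSucc] using h)
      rw [List.ofFn_succ (f := y), List.prod_cons, ← mul_smul_comm, ← this, List.ofFn_succ,
        List.prod_cons]
      simp only [Function.comp_def, h0, hs]

/-- Adjacent transpositions generate the symmetric group as a monoid. As `(s * τ)⁻¹ = τ⁻¹ * s`, a
new transposition on the left swaps two neighbours in the already permuted list. -/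
theorem prod_ofFn_perm {R : Type*} [Ring R] [Algebra ℂ R] {n : ℕ} (o : Fin n → ZMod 2)
    (x : Fin n → R)
    (h : ∀ j k, x j * x k = (if o k = 1 ∧ o j = 1 then (-1 : ℂ) else 1) • (x k * x j))
    (σ : Equiv.Perm (Fin n)) :
    (List.ofFn (x ∘ ⇑σ⁻¹)).prod = permSign o σ • (List.ofFn x).prod := by
  cases n with
  | zero => simp [Subsingleton.elim σ 1, permSign_one]
  | succ n =>
    have hσ : σ ∈ Submonoid.closure
        (Set.range fun i : Fin n => Equiv.swap i.castSucc i.succ) := by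
      rw [Equiv.Perm.mclosure_swap_castSucc_succ]
      trivial
    induction hσ using Submonoid.closure_induction_left with
    | one => simp [permSign_one]
    | mul_left s hs τ _ ih =>
      obtain ⟨i, rfl⟩ := hs
      have e : x ∘ ⇑(Equiv.swap i.castSucc i.succ * τ)⁻¹ =
          (x ∘ ⇑τ⁻¹) ∘ Equiv.swap i.castSucc i.succ := by
        funext k
        simp [mul_inv_rev]
      rw [e, prod_ofFn_swap_adjacent (x ∘ ⇑τ⁻¹) i (h _ _), ih, permSign_swap_mul, smul_smul]

/-! ### The Hilbert-Grassmann algebra -/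

namespace Grassmann

/-- The coefficient at `κ_A` as a continuous linear functional. -/
def coeffCLM (A : Finset ℕ) : Grassmann →L[ℂ] ℂ :=
  LinearMap.mkContinuous
    { toFun := fun x => coeff x A
      map_add' := fun x y => coeff_add x y A
      map_smul' := fun c x => coeff_smul c x A } (A.card ! : ℝ) fun x => by
    have h : ‖x.1 A‖ ≤ ‖x‖ :=
      lp.norm_apply_le_norm (by norm_num) (show lp (fun _ : Finset ℕ => ℂ) 2 from x) A
    simp only [LinearMap.coe_mk, AddHom.coe_mk, coeff, norm_mul, Complex.norm_natCast]
    gcongr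

theorem coeffCLM_apply (A : Finset ℕ) (x : Grassmann) : coeffCLM A x = coeff x A := rfl

/-- By disjointness each pair in `A ×ˢ B` is an inversion for exactly one of the two orders, so the
two counts add up to `|A| |B|`. -/
theorem wedgeSign_comm {A B : Finset ℕ} (h : Disjoint A B) :
    wedgeSign B A = (-1) ^ (A.card * B.card) * wedgeSign A B := by
  have h1 : ((B ×ˢ A).filter fun p => p.2 < p.1).card =
      ((A ×ˢ B).filter fun p => ¬p.2 < p.1).card := by
    refine Finset.card_nbij' (fun p => (p.2, p.1)) (fun p => (p.2, p.1)) ?_ ?_ ?_ ?_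
    · rintro ⟨b, a⟩ hp
      simp only [Finset.coe_filter, Finset.mem_product, Set.mem_ofPred_eq] at hp ⊢
      exact ⟨hp.1.symm, hp.2.not_gt⟩
    · rintro ⟨a, b⟩ hp
      simp only [Finset.coe_filter, Finset.mem_product, Set.mem_ofPred_eq] at hp ⊢
      refine ⟨hp.1.symm, lt_of_le_of_ne (not_lt.1 hp.2) ?_⟩
      exact Finset.disjoint_iff_ne.1 h _ hp.1.1 _ hp.1.2
    · intro p _
      rfl
    · intro p _
      rfl
  have h2 := Finset.card_filter_add_card_filter_not (s := A ×ˢ B) (fun p => p.2 < p.1)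
  rw [Finset.card_product] at h2
  rw [wedgeSign, wedgeSign, h1, ← h2, ← pow_add]
  rw [show ∀ a b : ℕ, a + b + a = b + 2 * a from fun a b => by ring, pow_add _ _ (2 * _)]
  simp

/-- Passing to complements in `C` puts `y * x` over the same index set as `x * y`, so that the two
products can be compared term by term. -/
theorem coeff_mul_reversed (x y : Grassmann) (C : Finset ℕ) :
    coeff (y * x) C = ∑ A ∈ C.powerset, (-1) ^ (A.card * (C \ A).card) *
      (wedgeSign A (C \ A) * (coeff x A * coeff y (C \ A))) := by
  rw [coeff_mul]
  refine Finset.sum_bij' (fun A _ => C \ A) (fun A _ => C \ A) ?_ ?_ ?_ ?_ ?_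
  · exact fun A _ => Finset.mem_powerset.2 Finset.sdiff_subset
  · exact fun A _ => Finset.mem_powerset.2 Finset.sdiff_subset
  · exact fun A hA => Finset.sdiff_sdiff_eq_self (Finset.mem_powerset.1 hA)
  · exact fun A hA => Finset.sdiff_sdiff_eq_self (Finset.mem_powerset.1 hA)
  · intro A hA
    rw [Finset.sdiff_sdiff_eq_self (Finset.mem_powerset.1 hA),
      wedgeSign_comm (A := C \ A) (B := A) Finset.sdiff_disjoint]
    ring

theorem coeff_star (x : Grassmann) (A : Finset ℕ) :
    coeff (star x) A = (-1) ^ (A.card * (A.card - 1) / 2) * (starRingEnd ℂ) (coeff x A) :=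
  coeff_ofCoeff _ _ _

/-- The cross term `p * q` is the exponent of the exchange sign; this is what makes the involution
reverse products. -/
theorem add_choose_two (p q : ℕ) :
    (p + q).choose 2 = p.choose 2 + q.choose 2 + p * q := by
  induction q with
  | zero => simp
  | succ q ih =>
    rw [← add_assoc, Nat.choose_succ_succ' (p + q) 1, Nat.choose_succ_succ' q 1, ih]
    simp only [Nat.choose_one_right]
    ring

theorem coeff_star_choose (x : Grassmann) (A : Finset ℕ) :
    coeff (star x) A = (-1) ^ (A.card.choose 2) * (starRingEnd ℂ) (coeff x A) := by
  rw [coeff_star, Nat.choose_two_right]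

instance : StarRing Grassmann where
  star_involutive := fun x => ext_coeff fun A => by
    rw [coeff_star, coeff_star, map_mul, ← mul_assoc]
    simp [← mul_pow]
  star_add := fun x y => ext_coeff fun A => by
    simp only [coeff_star, coeff_add, map_add, mul_add]
  star_mul := fun x y => ext_coeff fun C => by
    rw [coeff_mul_reversed, coeff_star_choose, coeff_mul, map_sum, Finset.mul_sum]
    refine Finset.sum_congr rfl fun A hA => ?_
    have hc : C.card = A.card + (C \ A).card := by
      rw [add_comm, Finset.card_sdiff_add_card_eq_card (Finset.mem_powerset.1 hA)]
    rw [coeff_star_choose, coeff_star_choose, hc, add_choose_two, pow_add, pow_add]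
    have hw : (starRingEnd ℂ) (wedgeSign A (C \ A)) = wedgeSign A (C \ A) := by simp [wedgeSign]
    rw [map_mul, map_mul, hw]
    ring

instance : StarModule ℂ Grassmann where
  star_smul := fun c x => ext_coeff fun A => by
    rw [coeff_smul, coeff_star, coeff_star, coeff_smul, map_mul]
    exact mul_left_comm _ _ _

theorem norm_star_eq (x : Grassmann) : ‖star x‖ = ‖x‖ := by
  have h : ‖star x‖ ^ 2 = ‖x‖ ^ 2 := by
    rw [norm_sq_eq, norm_sq_eq]
    refine tsum_congr fun A => ?_
    have h0 : (A.card ! : ℝ) ≠ 0 := by exact_mod_cast Nat.factorial_ne_zero _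
    have h1 := congrArg norm (coeff_star x A)
    simp only [coeff, norm_mul, norm_pow, norm_neg, norm_one, one_pow, one_mul,
      RCLike.norm_conj] at h1
    rw [Complex.norm_natCast] at h1
    rw [mul_left_cancel₀ h0 h1]
  exact (sq_eq_sq₀ (norm_nonneg _) (norm_nonneg _)).1 h

theorem norm_one_eq : ‖(1 : Grassmann)‖ = 1 := by
  have h : ‖(1 : Grassmann)‖ ^ 2 = 1 := by
    have h1 : ∀ A : Finset ℕ, (1 : Grassmann).1 A = if A = ∅ then 1 else 0 := fun A => by
      have h0 : (A.card ! : ℂ) ≠ 0 := by exact_mod_cast Nat.factorial_ne_zero _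
      have := coeff_one A
      rw [coeff] at this
      refine mul_left_cancel₀ h0 (this.trans ?_)
      split_ifs with hA <;> simp [hA]
    rw [norm_sq_eq, tsum_eq_single ∅]
    · simp [h1]
    · intro A hA
      simp [h1, hA]
  exact (sq_eq_sq₀ (norm_nonneg _) zero_le_one).1 (by simpa using h)

theorem star_mem_part {k : ZMod 2} {x : Grassmann} (hx : x ∈ part k) : star x ∈ part k :=
  fun A hA => by rw [coeff_star, hx A hA, map_zero, mul_zero]

theorem one_mem_part : (1 : Grassmann) ∈ part 0 := fun A hA => by
  rw [coeff_one, if_neg]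
  rintro rfl
  simp at hA

theorem mul_mem_part {k l : ZMod 2} {x y : Grassmann} (hx : x ∈ part k) (hy : y ∈ part l) :
    x * y ∈ part (k + l) := fun C hC => by
  rw [coeff_mul]
  refine Finset.sum_eq_zero fun A hA => ?_
  by_cases hk : (A.card : ZMod 2) = k
  · have hl : ((C \ A).card : ZMod 2) ≠ l := by
      rintro rfl
      apply hC
      rw [← hk, ← Nat.cast_add, add_comm,
        Finset.card_sdiff_add_card_eq_card (Finset.mem_powerset.1 hA)]
    rw [hy _ hl, mul_zero, mul_zero]
  · rw [hx _ hk, zero_mul, mul_zero]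

theorem tsum_mem_part {ι : Type*} {k : ZMod 2} {f : ι → Grassmann} (h : ∀ i, f i ∈ part k) :
    ∑' i, f i ∈ part k := by
  by_cases hs : Summable f
  · intro A hA
    rw [← coeffCLM_apply, (coeffCLM A).map_tsum hs]
    exact (tsum_congr fun i => h i A hA).trans tsum_zero
  -- Without summability `tsum` takes the default value `0`, which also lies in the subspace.
  · rw [tsum_eq_zero_of_not_summable hs]
    exact (part k).zero_mem

/-- Termwise the exchange sign is `(-1) ^ (|A| |C \ A|)`, and nonzero terms have `|A|` of parity `k`
and `|C \ A|` of parity `l`. -/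
theorem mul_eq_smul_mul {k l : ZMod 2} {x y : Grassmann} (hx : x ∈ part k) (hy : y ∈ part l) :
    x * y = (if l = 1 ∧ k = 1 then (-1 : ℂ) else 1) • (y * x) := by
  refine ext_coeff fun C => ?_
  rw [coeff_smul, coeff_mul_reversed x y, coeff_mul x y, Finset.mul_sum]
  refine Finset.sum_congr rfl fun A _ => ?_
  by_cases hk : (A.card : ZMod 2) = k
  · by_cases hl : ((C \ A).card : ZMod 2) = l
    · have : (if l = 1 ∧ k = 1 then (-1 : ℂ) else 1) * (-1) ^ (A.card * (C \ A).card) = 1 := by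
        simp only [← hk, ← hl, ZMod.natCast_eq_one_iff_odd]
        split_ifs with h
        · rw [(h.2.mul h.1).neg_one_pow]
          norm_num
        · rw [not_and_or, Nat.not_odd_iff_even, Nat.not_odd_iff_even] at h
          rw [one_mul, Even.neg_one_pow]
          rw [Nat.even_mul]
          tauto
      rw [← mul_assoc (if l = 1 ∧ k = 1 then (-1 : ℂ) else 1), this, one_mul]
    · simp [hy _ hl]
  · simp [hx _ hk]

theorem mul_comm_of_mem_part_zero {x : Grassmann} (hx : x ∈ part 0) (y : Grassmann) :
    x * y = y * x := by
  refine ext_coeff fun C => ?_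
  rw [coeff_mul_reversed x y, coeff_mul x y]
  refine Finset.sum_congr rfl fun A _ => ?_
  by_cases hk : (A.card : ZMod 2) = 0
  · rw [ZMod.natCast_eq_zero_iff_even] at hk
    rw [(hk.mul_right _).neg_one_pow, one_mul]
  · simp [hx _ hk]

theorem norm_prod_ofFn_le {n : ℕ} (x : Fin n → Grassmann) :
    ‖(List.ofFn x).prod‖ ≤ 2 ^ n * ∏ k, ‖x k‖ := by
  induction n with
  | zero => simp [norm_one_eq]
  | succ n ih =>
    rw [List.ofFn_succ, List.prod_cons, Fin.prod_univ_succ]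
    refine (norm_mul_le' _ _).trans ?_
    calc 2 * ‖x 0‖ * ‖(List.ofFn fun i : Fin n => x i.succ).prod‖
        ≤ 2 * ‖x 0‖ * (2 ^ n * ∏ k : Fin n, ‖x k.succ‖) := by gcongr; exact ih _
      _ = _ := by ring

theorem star_prod_ofFn {n : ℕ} (x : Fin n → Grassmann) :
    star (List.ofFn x).prod = (List.ofFn fun k : Fin n => star (x k.rev)).prod := by
  induction n with
  | zero => simp
  | succ n ih =>
    rw [List.ofFn_succ, List.prod_cons, star_mul, ih, List.ofFn_succ_last, List.prod_append,
      List.prod_singleton]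
    simp [Fin.rev_castSucc]

/-! ### Multiplication by basis monomials -/

theorem coeff_kappa (B A : Finset ℕ) : coeff (kappa B) A = if A = B then 1 else 0 :=
  coeff_ofCoeff _ _ _

theorem kappa_mem_part (B : Finset ℕ) : kappa B ∈ part (B.card : ZMod 2) := fun A hA => by
  rw [coeff_kappa, if_neg]
  rintro rfl
  exact hA rfl

theorem wedgeSign_ne_zero (A B : Finset ℕ) : wedgeSign A B ≠ 0 := by simp [wedgeSign]

theorem coeff_kappa_mul {B A : Finset ℕ} (h : Disjoint B A) (y : Grassmann) :
    coeff (kappa B * y) (B ∪ A) = wedgeSign B A * coeff y A := by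
  rw [coeff_mul, Finset.sum_eq_single_of_mem B
    (Finset.mem_powerset.2 Finset.subset_union_left)]
  · simp [coeff_kappa, Finset.union_sdiff_cancel_left h]
  · intro C _ hC
    simp [coeff_kappa, hC]

/-- Left multiplication by a product of monomials in distinct generators, none of which occurs
in `κ_A`, does not annihilate elements whose coefficient at `κ_A` is not zero. -/
theorem coeff_eq_zero_of_prod_kappa_mul {n : ℕ} (B : Fin n → Finset ℕ) (A : Finset ℕ)
    (hB : Pairwise fun j k => Disjoint (B j) (B k)) (hA : ∀ k, Disjoint (B k) A) (y : Grassmann)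
    (h : (List.ofFn fun k => kappa (B k)).prod * y = 0) : coeff y A = 0 := by
  induction n generalizing A y with
  | zero => simpa using congrArg (coeff · A) h
  | succ n ih =>
    rw [List.ofFn_succ_last, List.prod_append, List.prod_singleton, mul_assoc] at h
    have h1 := ih (fun k => B k.castSucc) (B (Fin.last n) ∪ A)
      (fun j k hjk => hB fun h => hjk (Fin.castSucc_injective _ h))
      (fun k => Finset.disjoint_union_right.2 ⟨hB (Fin.castSucc_lt_last k).ne, hA _⟩) _ h
    rw [coeff_kappa_mul (hA _)] at h1
    exact (mul_eq_zero.1 h1).resolve_left (wedgeSign_ne_zero _ _)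

end Grassmann

open Grassmann

/-! ### Series over multi-indices -/

/-- Stated for topological rings so that it serves both `Λ` and the real norm series; summability
over multi-indices is then an assumption. -/
theorem hasSum_prod_ofFn {R ι : Type*} [Ring R] [TopologicalSpace R] [IsTopologicalRing R]
    [T3Space R] {e : ι → R} {x : R} (he : HasSum e x)
    (hs : ∀ n, Summable fun a : Fin n → ι => (List.ofFn fun k => e (a k)).prod) (n : ℕ) :
    HasSum (fun a : Fin n → ι => (List.ofFn fun k => e (a k)).prod) (x ^ n) := by
  induction n with
  | zero =>
    simp only [List.ofFn_zero, List.prod_nil, pow_zero]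
    exact hasSum_unique (fun _ : Fin 0 → ι => (1 : R))
  | succ n ih =>
    have h1 : Summable fun p : ι × (Fin n → ι) => e p.1 * (List.ofFn fun k => e (p.2 k)).prod := by
      refine ((Fin.consEquiv fun _ : Fin (n + 1) => ι).summable_iff.2 (hs (n + 1))).congr
        fun p => ?_
      simp [Fin.consEquiv]
    have h2 := he.mul ih h1
    rw [pow_succ', ← (Fin.consEquiv fun _ : Fin (n + 1) => ι).hasSum_iff]
    refine h2.congr_fun fun p => ?_
    simp [Fin.consEquiv]

theorem summable_prod_of_nonneg {ι : Type*} {u : ι → ℝ} (h0 : ∀ i, 0 ≤ u i) (hu : Summable u)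
    (n : ℕ) : Summable fun a : Fin n → ι => ∏ k, u (a k) := by
  induction n with
  | zero => exact (hasSum_unique _).summable
  | succ n ih =>
    rw [← (Fin.consEquiv fun _ : Fin (n + 1) => ι).summable_iff]
    refine (hu.mul_of_nonneg ih h0 fun a => Finset.prod_nonneg fun k _ => h0 _).congr fun p => ?_
    simp [Fin.consEquiv, Fin.prod_univ_succ]

theorem tsum_prod_of_nonneg {ι : Type*} {u : ι → ℝ} (h0 : ∀ i, 0 ≤ u i) (hu : Summable u)
    (n : ℕ) : ∑' a : Fin n → ι, ∏ k, u (a k) = (∑' i, u i) ^ n := by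
  simpa [List.prod_ofFn] using (hasSum_prod_ofFn hu.hasSum
    (fun n => by simpa [List.prod_ofFn] using summable_prod_of_nonneg h0 hu n) n).tsum_eq

variable {ι₀ ι₁ : Type*}

/-! ### Ordered products of the components of a supervector -/

/-- The coefficient `ζ_{a₁} ⋯ ζ_{aₙ}` of the tensor power `ζ ⊗ ⋯ ⊗ ζ`. -/
def ordProd (ζ : Idx ι₀ ι₁ → Grassmann) {n : ℕ} (a : Fin n → Idx ι₀ ι₁) : Grassmann :=
  (List.ofFn fun k => ζ (a k)).prod

theorem gradedProj_smul {n : ℕ} (c : ℂ) (F : (Fin n → Idx ι₀ ι₁) → Grassmann) :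
    gradedProj (c • F) = c • gradedProj F := by
  funext b
  simp only [gradedProj, Pi.smul_apply, Finset.smul_sum]
  exact Finset.sum_congr rfl fun σ _ => by simp only [smul_smul]; congr 1; ring

theorem gradedProj_sub {n : ℕ} (F G : (Fin n → Idx ι₀ ι₁) → Grassmann) :
    gradedProj (F - G) = gradedProj F - gradedProj G := by
  funext b
  simp only [gradedProj, Pi.sub_apply, smul_sub, Finset.sum_sub_distrib]

theorem ordProd_perm {ζ : Idx ι₀ ι₁ → Grassmann} (hζ : ∀ i, ζ i ∈ part (parity i)) {n : ℕ}
    (σ : Equiv.Perm (Fin n)) (b : Fin n → Idx ι₀ ι₁) :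
    ordProd ζ (b ∘ ⇑σ⁻¹) = permSign (fun k => parity (b k)) σ • ordProd ζ b :=
  prod_ofFn_perm (fun k => parity (b k)) (fun k => ζ (b k))
    (fun _ _ => mul_eq_smul_mul (hζ _) (hζ _)) σ

/-- The reordering sign of the product equals the sign in the projection; their product is `1`, and
an average of `n!` equal terms remains. -/
theorem gradedProj_ordProd {ζ : Idx ι₀ ι₁ → Grassmann} (hζ : ∀ i, ζ i ∈ part (parity i)) (n : ℕ) :
    gradedProj (fun a : Fin n → Idx ι₀ ι₁ => ordProd ζ a) = fun a => ordProd ζ a := by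
  funext b
  have h0 : (n ! : ℂ) ≠ 0 := by exact_mod_cast Nat.factorial_ne_zero _
  simp only [gradedProj, ordProd_perm hζ, gradedSign_comp_inv, smul_smul, permSign_mul_self,
    one_smul, Finset.sum_const, Finset.card_univ, Fintype.card_perm, Fintype.card_fin]
  rw [← Nat.cast_smul_eq_nsmul ℂ, smul_smul, inv_mul_cancel₀ h0, one_smul]

/-- Each multiplication by `ζ` contributes `√((p+1)! / p!)`, and these factors telescope. -/
theorem vecPow_eq {ζ : Idx ι₀ ι₁ → Grassmann} (hζ : ∀ i, ζ i ∈ part (parity i)) (p : ℕ) :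
    vecPow ζ p = ((Real.sqrt (p ! : ℝ) : ℝ) : ℂ) • fun a => ordProd ζ a := by
  induction p with
  | zero =>
    funext a
    simp [vecPow, ordProd]
  | succ p ih =>
    have h : (fun a : Fin (p + 1) → Idx ι₀ ι₁ =>
        vecPow ζ p (fun k => a (Fin.castAdd 1 k)) * ζ (a (Fin.natAdd p 0))) =
        ((Real.sqrt (p ! : ℝ) : ℝ) : ℂ) • fun a => ordProd ζ a := by
      funext a
      rw [ih, Pi.smul_apply, Pi.smul_apply, smul_mul_assoc]
      simp only [ordProd]
      rw [List.ofFn_succ_last, List.prod_append, List.prod_singleton]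
      rfl
    rw [vecPow, gradedMul, h, gradedProj_smul, gradedProj_ordProd hζ, smul_smul,
      ← Complex.ofReal_mul, ← Real.sqrt_mul (by positivity)]
    have h0 : (p ! : ℝ) ≠ 0 := by exact_mod_cast Nat.factorial_ne_zero _
    rw [Nat.factorial_one, Nat.cast_one, mul_one, div_mul_cancel₀ _ h0]

theorem coherent_apply {ζ : Idx ι₀ ι₁ → Grassmann} (hζ : ∀ i, ζ i ∈ part (parity i)) {p : ℕ}
    (a : Fin p → Idx ι₀ ι₁) :
    coherent ζ p a = (((Real.sqrt (p ! : ℝ))⁻¹ : ℝ) : ℂ) • ordProd ζ a := by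
  rw [coherent, vecPow_eq hζ, Pi.smul_apply, smul_smul]
  congr 1
  have h0 : (0 : ℝ) < p ! := by exact_mod_cast Nat.factorial_pos _
  have h1 := Real.mul_self_sqrt h0.le
  have h2 : Real.sqrt (p ! : ℝ) ≠ 0 := (Real.sqrt_pos.2 h0).ne'
  have h3 : ((p ! : ℝ))⁻¹ * Real.sqrt (p ! : ℝ) = (Real.sqrt (p ! : ℝ))⁻¹ := by
    rw [eq_comm, inv_eq_iff_eq_inv, mul_inv, inv_inv, ← div_eq_mul_inv, eq_div_iff h2, h1]
  rw [← h3]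
  push_cast
  rfl

/-! ### Square summable families of elements of `Λ` -/

theorem memℓp_two_iff {ι : Type*} (f : ι → Grassmann) :
    Memℓp f 2 ↔ Summable fun i => ‖f i‖ ^ 2 := by
  simpa using memℓp_gen_iff (f := f) (p := 2) (by norm_num)

theorem summable_mul_of_memℓp {ι : Type*} {f g : ι → Grassmann} (hf : Memℓp f 2)
    (hg : Memℓp g 2) : Summable fun i => ‖f i * g i‖ := by
  rw [memℓp_two_iff] at hf hg
  refine Summable.of_nonneg_of_le (fun _ => norm_nonneg _) (fun i => ?_) (hf.add hg)
  have := norm_mul_le' (f i) (g i)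
  -- The constant `2` of `norm_mul_le'` is exactly absorbed by `2ab ≤ a² + b²`.
  nlinarith [sq_nonneg (‖f i‖ - ‖g i‖)]

/-- Squaring the bound `2 ^ n` for `n`-fold products gives `4 ^ n`, so the squared norm is dominated
by the exponential series of `4 ∑ ‖ζ i‖²`. -/
theorem coherent_mem_fockSpace {ζ : Idx ι₀ ι₁ → Grassmann} (h2 : Memℓp ζ 2)
    (hζ : ∀ i, ζ i ∈ part (parity i)) : coherent ζ ∈ FockSpace ι₀ ι₁ := by
  refine ⟨?_, fun n => ?_⟩
  · rw [memℓp_two_iff] at h2 ⊢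
    have hu : ∀ i : Idx ι₀ ι₁, 0 ≤ ‖ζ i‖ ^ 2 := fun i => sq_nonneg _
    have hle : ∀ s : (Σ n, (Fin n → Idx ι₀ ι₁)), ‖coherent ζ s.1 s.2‖ ^ 2 ≤
        ((s.1 ! : ℝ))⁻¹ * 4 ^ s.1 * ∏ k, ‖ζ (s.2 k)‖ ^ 2 := by
      rintro ⟨n, a⟩
      have h0 : (0 : ℝ) ≤ n ! := by positivity
      rw [coherent_apply hζ, norm_smul, mul_pow, Complex.norm_real, Real.norm_eq_abs, sq_abs,
        inv_pow, Real.sq_sqrt h0, mul_assoc]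
      gcongr
      refine (pow_le_pow_left₀ (norm_nonneg _) (norm_prod_ofFn_le _) 2).trans (le_of_eq ?_)
      rw [mul_pow, Finset.prod_pow, ← pow_mul, mul_comm n 2, pow_mul]
      norm_num
    refine Summable.of_nonneg_of_le (fun _ => sq_nonneg _) hle ?_
    have h0 : ∀ s : (Σ n, (Fin n → Idx ι₀ ι₁)),
        0 ≤ ((s.1 ! : ℝ))⁻¹ * 4 ^ s.1 * ∏ k, ‖ζ (s.2 k)‖ ^ 2 := fun s => by
      refine le_trans ?_ (hle s)
      exact sq_nonneg _
    refine (summable_sigma_of_nonneg h0).2 ⟨fun n => ?_, ?_⟩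
    · dsimp only
      exact (summable_prod_of_nonneg hu h2 n).mul_left (((n ! : ℝ))⁻¹ * 4 ^ n)
    · refine (Real.summable_pow_div_factorial (4 * ∑' i, ‖ζ i‖ ^ 2)).congr fun n => ?_
      dsimp only
      rw [tsum_mul_left, tsum_prod_of_nonneg hu h2, mul_pow]
      ring
  · have h : coherent ζ n = (((Real.sqrt (n ! : ℝ))⁻¹ : ℝ) : ℂ) • fun a => ordProd ζ a :=
      funext fun a => coherent_apply hζ a
    rw [h, gradedProj_smul, gradedProj_ordProd hζ]

theorem coherent_mem (η : DiagSuperspace ι₀ ι₁) : coherent η.1 ∈ FockSpace ι₀ ι₁ :=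
  coherent_mem_fockSpace η.2.1.1 η.2.1.2

/-! ### The forms -/

theorem conjIdx_conjIdx (i : Idx ι₀ ι₁) : conjIdx (conjIdx i) = i := by
  simp [conjIdx]

/-- The label of the basis tensor dual to the one with the label `a`. -/
def dualIdx {n : ℕ} (a : Fin n → Idx ι₀ ι₁) : Fin n → Idx ι₀ ι₁ := fun k => conjIdx (a k.rev)

theorem dualIdx_dualIdx {n : ℕ} (a : Fin n → Idx ι₀ ι₁) : dualIdx (dualIdx a) = a := by
  funext k
  simp [dualIdx, conjIdx_conjIdx]

/-- Passage to the label of the dual basis tensor, in all degrees. -/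
def dualEquiv : (Σ n, (Fin n → Idx ι₀ ι₁)) ≃ (Σ n, (Fin n → Idx ι₀ ι₁)) :=
  Function.Involutive.toPerm (fun s => ⟨s.1, dualIdx s.2⟩) fun s => by
    simp only [dualIdx_dualIdx]

theorem dualEquiv_apply (s : Σ n, (Fin n → Idx ι₀ ι₁)) : dualEquiv s = ⟨s.1, dualIdx s.2⟩ := rfl

theorem memℓp_dualEquiv {Ξ : TensorFamily ι₀ ι₁}
    (hΞ : Memℓp (fun s : (Σ n, (Fin n → Idx ι₀ ι₁)) => Ξ s.1 s.2) 2) :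
    Memℓp (fun s : (Σ n, (Fin n → Idx ι₀ ι₁)) => Ξ s.1 (dualIdx s.2)) 2 := by
  rw [memℓp_two_iff] at hΞ ⊢
  refine (hΞ.comp_injective dualEquiv.injective).congr fun s => ?_
  rw [Function.comp_apply, dualEquiv_apply]

theorem summable_norm_pairingTerm {Ξ Η : TensorFamily ι₀ ι₁}
    (hΞ : Memℓp (fun s : (Σ n, (Fin n → Idx ι₀ ι₁)) => Ξ s.1 s.2) 2)
    (hΗ : Memℓp (fun s : (Σ n, (Fin n → Idx ι₀ ι₁)) => Η s.1 s.2) 2) :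
    Summable fun s => ‖pairingTerm Ξ Η s‖ := by
  exact summable_mul_of_memℓp (memℓp_dualEquiv hΞ) hΗ

theorem summable_pairingTerm {Ξ Η : TensorFamily ι₀ ι₁}
    (hΞ : Memℓp (fun s : (Σ n, (Fin n → Idx ι₀ ι₁)) => Ξ s.1 s.2) 2)
    (hΗ : Memℓp (fun s : (Σ n, (Fin n → Idx ι₀ ι₁)) => Η s.1 s.2) 2) :
    Summable (pairingTerm Ξ Η) :=
  (summable_norm_pairingTerm hΞ hΗ).of_norm

theorem memℓp_fockStar {Ξ : TensorFamily ι₀ ι₁}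
    (hΞ : Memℓp (fun s : (Σ n, (Fin n → Idx ι₀ ι₁)) => Ξ s.1 s.2) 2) :
    Memℓp (fun s : (Σ n, (Fin n → Idx ι₀ ι₁)) => fockStar Ξ s.1 s.2) 2 := by
  have h := memℓp_dualEquiv hΞ
  rw [memℓp_two_iff] at h ⊢
  refine h.congr fun s => ?_
  rw [fockStar, norm_star_eq]
  rfl

theorem apply_conjIdx_of_mem {ζ : Idx ι₀ ι₁ → Grassmann} (h : vecStar ζ = ζ) (i : Idx ι₀ ι₁) :
    star (ζ (conjIdx i)) = ζ i := congrFun h i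

/-- The star reverses the product of components while `fockStar` reverses the labels; the reversals
cancel, and reality of `ζ` absorbs the conjugation. -/
theorem fockStar_coherent (ζ : DiagSuperspace ι₀ ι₁) :
    fockStar (coherent ζ.1) = coherent ζ.1 := by
  funext n a
  rw [fockStar, coherent_apply ζ.2.1.2, coherent_apply ζ.2.1.2, star_smul, ordProd,
    star_prod_ofFn, ordProd]
  simp only [Fin.rev_rev, apply_conjIdx_of_mem ζ.2.2]
  rw [RCLike.star_def, Complex.conj_ofReal]

theorem kernel_eq_phi (ζ η : DiagSuperspace ι₀ ι₁) : kernel ζ η = phi (coherent η.1) ζ := by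
  rw [kernel, sesq, fockStar_coherent, phi]

theorem vecSesq_eq (ζ₁ ζ₂ : DiagSuperspace ι₀ ι₁) :
    vecSesq ζ₁.1 ζ₂.1 = vecPairing ζ₁.1 ζ₂.1 := by
  rw [vecSesq, ζ₁.2.2]

theorem parity_conjIdx (i : Idx ι₀ ι₁) : parity (conjIdx i) = parity i := rfl

theorem mul_conj_mem_part_zero (ζ η : DiagSuperspace ι₀ ι₁) (i : Idx ι₀ ι₁) :
    ζ.1 (conjIdx i) * η.1 i ∈ part 0 := by
  have h := mul_mem_part (ζ.2.1.2 (conjIdx i)) (η.2.1.2 i)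
  rwa [parity_conjIdx, CharTwo.add_self_eq_zero] at h

theorem summable_norm_vecPairing (ζ η : DiagSuperspace ι₀ ι₁) :
    Summable fun i => ‖ζ.1 (conjIdx i) * η.1 i‖ := by
  refine summable_mul_of_memℓp (f := fun i => ζ.1 (conjIdx i)) ?_ η.2.1.1
  have h := ζ.2.1.1
  rw [memℓp_two_iff] at h ⊢
  exact h.comp_injective (Function.Involutive.injective conjIdx_conjIdx)

/-- The left side is nested, `ζ_{aₙ*} ⋯ ζ_{a₁*} η_{a₁} ⋯ η_{aₙ}`. The innermost pair is even, hence
moves to the front, and the rest has the same shape. -/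
theorem ordProd_dualIdx_mul (ζ η : DiagSuperspace ι₀ ι₁) {n : ℕ} (a : Fin n → Idx ι₀ ι₁) :
    ordProd ζ.1 (dualIdx a) * ordProd η.1 a =
      (List.ofFn fun k => ζ.1 (conjIdx (a k)) * η.1 (a k)).prod := by
  induction n with
  | zero => simp [ordProd]
  | succ n ih =>
    have h := ih fun k => a k.succ
    simp only [ordProd, dualIdx] at h ⊢
    rw [List.ofFn_succ_last, List.prod_append, List.prod_singleton, List.ofFn_succ (n := n),
      List.prod_cons, List.ofFn_succ (n := n), List.prod_cons, ← h, ← mul_assoc,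
      mul_assoc _ _ (η.1 (a 0)), Fin.rev_last,
      ← mul_comm_of_mem_part_zero (mul_conj_mem_part_zero ζ η (a 0))]
    simp only [mul_assoc, Fin.rev_castSucc]

theorem pairingTerm_coherent (ζ η : DiagSuperspace ι₀ ι₁) (s : Σ n, (Fin n → Idx ι₀ ι₁)) :
    pairingTerm (coherent ζ.1) (coherent η.1) s =
      ((s.1 ! : ℂ))⁻¹ • (List.ofFn fun k => ζ.1 (conjIdx (s.2 k)) * η.1 (s.2 k)).prod := by
  rw [pairingTerm, coherent_apply ζ.2.1.2, coherent_apply η.2.1.2, smul_mul_smul_comm,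
    ← ordProd_dualIdx_mul]
  congr 1
  rw [← Complex.ofReal_mul, ← mul_inv, Real.mul_self_sqrt (by positivity)]
  simp

theorem kernel_eq_exp (ζ η : DiagSuperspace ι₀ ι₁) :
    kernel ζ η = NormedSpace.exp (vecPairing ζ.1 η.1) := by
  have hn := summable_norm_vecPairing ζ η
  have hs : ∀ n, Summable fun a : Fin n → Idx ι₀ ι₁ =>
      (List.ofFn fun k => ζ.1 (conjIdx (a k)) * η.1 (a k)).prod := fun n =>
    Summable.of_norm_bounded ((summable_prod_of_nonneg (fun _ => norm_nonneg _) hn n).mul_left _)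
      fun a => norm_prod_ofFn_le _
  have hp := hasSum_prod_ofFn hn.of_norm.hasSum hs
  have hsum := summable_pairingTerm (coherent_mem ζ).1 (coherent_mem η).1
  rw [kernel_eq_phi, phi, pairing, hsum.tsum_sigma, NormedSpace.exp_eq_tsum ℂ]
  refine tsum_congr fun n => ?_
  simp only [pairingTerm_coherent]
  exact ((hp n).const_smul _).tsum_eq

theorem kernel_mem_part_zero (ζ η : DiagSuperspace ι₀ ι₁) : kernel ζ η ∈ part 0 := by
  rw [kernel_eq_phi, phi, pairing]
  refine tsum_mem_part fun s => ?_
  rw [pairingTerm_coherent]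
  refine (part 0).smul_mem _ ?_
  rw [List.ofFn_eq_map]
  generalize List.finRange s.1 = l
  induction l with
  | nil => exact one_mem_part
  | cons k l ih =>
    rw [List.map_cons, List.prod_cons]
    simpa using mul_mem_part (mul_conj_mem_part_zero ζ η (s.2 k)) ih

/-! ### Power series and multilinear maps vanishing on real points -/

/-- Uniqueness of power series expansions of the zero function. Convergence at `t = 1` makes `q`
tend to zero, which gives radius at least `1`. -/
theorem eq_zero_of_hasSum_pow_smul {E : Type*} [NormedAddCommGroup E] [NormedSpace ℝ E] {q : ℕ → E}
    (h : ∀ t : ℝ, HasSum (fun n => t ^ n • q n) 0) (n : ℕ) : q n = 0 := by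
  let p : FormalMultilinearSeries ℝ ℝ E := fun n =>
    ContinuousMultilinearMap.mkPiRing ℝ (Fin n) (q n)
  have hp : HasFPowerSeriesOnBall (0 : ℝ → E) p 0 1 :=
    { r_le := by
        refine p.le_radius_of_tendsto (r := 1) (l := 0) ?_
        have h1 := (h 1).summable.tendsto_atTop_zero.norm
        simpa [p] using h1
      r_pos := zero_lt_one
      hasSum := fun {y} _ => by
        simpa [p, ContinuousMultilinearMap.mkPiRing_apply] using h y }
  have h0 := congrFun hp.hasFPowerSeriesAt.eq_zero n
  have h1 := congrArg (fun f => f fun _ => (1 : ℝ)) h0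
  simpa [p, ContinuousMultilinearMap.mkPiRing_apply] using h1

/-- Toggling an element `k ∉ R` in `T` is a sign-reversing involution on the supersets of `R`. -/
theorem sum_neg_one_pow_card_superset {n : ℕ} (R : Finset (Fin n)) (hR : R ≠ Finset.univ) :
    ∑ T : Finset (Fin n), (if R ⊆ T then (-1 : ℂ) ^ T.card else 0) = 0 := by
  obtain ⟨k, hk⟩ : ∃ k, k ∉ R := by
    by_contra! h
    exact hR (Finset.eq_univ_of_forall h)
  have hT : ∀ T : Finset (Fin n), R ⊆ symmDiff T {k} ↔ R ⊆ T := fun T => by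
    refine ⟨fun h x hx => ?_, fun h x hx => ?_⟩ <;>
    · have h1 := h hx
      have h2 : x ≠ k := fun h => hk (h ▸ hx)
      simp only [Finset.mem_symmDiff, Finset.mem_singleton] at h1 ⊢
      tauto
  have hc : ∀ T : Finset (Fin n), (-1 : ℂ) ^ (symmDiff T {k}).card = -(-1) ^ T.card := fun T => by
    by_cases h : k ∈ T
    · have h1 : symmDiff T {k} = T.erase k := by
        ext x
        simp only [Finset.mem_symmDiff, Finset.mem_singleton, Finset.mem_erase]
        constructor
        · rintro (h2 | ⟨rfl, h2⟩)
          · exact ⟨h2.2, h2.1⟩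
          · exact absurd h h2
        · exact fun h2 => Or.inl ⟨h2.2, h2.1⟩
      rw [h1, ← Finset.card_erase_add_one h, pow_succ]
      ring
    · have h1 : symmDiff T {k} = insert k T := by
        ext x
        simp only [Finset.mem_symmDiff, Finset.mem_singleton, Finset.mem_insert]
        constructor
        · tauto
        · rintro (rfl | h2)
          · exact Or.inr ⟨rfl, h⟩
          · exact Or.inl ⟨h2, fun h3 => h (h3 ▸ h2)⟩
      rw [h1, Finset.card_insert_of_notMem h, pow_succ]
      ring
  refine Finset.sum_ninvolution (fun T => symmDiff T {k}) ?_ ?_ ?_ ?_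
  · intro T
    simp only [hT, hc]
    split_ifs <;> simp
  · intro T _ h
    have := congrArg (k ∈ ·) h
    simp [Finset.mem_symmDiff] at this
  · simp
  · intro T
    simp

/-- Polarization by inclusion-exclusion: after expanding the diagonal values, the alternating sum
over `T` keeps only the surjective `r`, that is, the permutations. Only subset sums of the `v k`
occur, so the lemma applies to real points. -/
theorem sum_perm_eq_zero_of_diag {V W : Type*} [AddCommGroup V] [Module ℂ V] [AddCommGroup W]
    [Module ℂ W] {n : ℕ} (M : MultilinearMap ℂ (fun _ : Fin n => V) W) (v : Fin n → V)
    (h : ∀ T : Finset (Fin n), (M fun _ => ∑ k ∈ T, v k) = 0) :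
    ∑ σ : Equiv.Perm (Fin n), M (fun k => v (σ k)) = 0 := by
  classical
  have h1 : ∑ T : Finset (Fin n), (-1 : ℂ) ^ T.card • (M fun _ => ∑ k ∈ T, v k) = 0 :=
    Finset.sum_eq_zero fun T _ => by rw [h, smul_zero]
  have h2 : ∀ T : Finset (Fin n), (M fun _ => ∑ k ∈ T, v k) =
      ∑ r : Fin n → Fin n, if Finset.univ.image r ⊆ T then M (fun k => v (r k)) else 0 := fun T => by
    rw [M.map_sum_finset (fun _ k => v k) fun _ => T, ← Finset.sum_filter]
    refine Finset.sum_congr ?_ fun _ _ => rfl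
    ext r
    simp [Finset.image_subset_iff, Fintype.mem_piFinset]
  have h3 : ∑ r : Fin n → Fin n, (∑ T : Finset (Fin n),
      if Finset.univ.image r ⊆ T then (-1 : ℂ) ^ T.card else 0) • M (fun k => v (r k)) = 0 := by
    rw [← h1]
    simp only [h2, Finset.smul_sum, Finset.sum_smul]
    rw [Finset.sum_comm]
    refine Finset.sum_congr rfl fun T _ => Finset.sum_congr rfl fun r _ => ?_
    split_ifs <;> simp
  have h4 : ∑ σ : Equiv.Perm (Fin n), (-1 : ℂ) ^ n • M (fun k => v (σ k)) = 0 := by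
    rw [← h3]
    refine Finset.sum_of_injOn (fun σ => ⇑σ) DFunLike.coe_injective.injOn
      (fun _ _ => Finset.mem_coe.2 (Finset.mem_univ _)) ?_ ?_
    · intro r _ hr
      rw [sum_neg_one_pow_card_superset, zero_smul]
      intro hs
      apply hr
      have hsurj : Function.Surjective r := fun k => by
        simpa using hs.ge (Finset.mem_univ k)
      exact ⟨Equiv.ofBijective r (Finite.surjective_iff_bijective.1 hsurj), by simp⟩
    · intro σ _
      have hs : Finset.univ.image ⇑σ = Finset.univ :=
        Finset.image_univ_of_surjective σ.surjective
      simp only [hs, Finset.univ_subset_iff]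
      rw [Finset.sum_ite_eq' Finset.univ Finset.univ, if_pos (Finset.mem_univ _), Finset.card_univ,
        Fintype.card_fin]
  rw [← Finset.smul_sum] at h4
  exact (smul_eq_zero.1 h4).resolve_left (by simp)

/-- The slots are released from `D` to its span one at a time. -/
theorem multilinear_eq_zero_of_span {V W : Type*} [AddCommGroup V] [Module ℂ V] [AddCommGroup W]
    [Module ℂ W] {n : ℕ} (N : MultilinearMap ℂ (fun _ : Fin n => V) W) (D : Set V)
    (h : ∀ v : Fin n → V, (∀ k, v k ∈ D) → N v = 0) (v : Fin n → V)
    (hv : ∀ k, v k ∈ Submodule.span ℂ D) : N v = 0 := by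
  have key : ∀ s : Finset (Fin n), ∀ v : Fin n → V, (∀ k ∈ s, v k ∈ Submodule.span ℂ D) →
      (∀ k ∉ s, v k ∈ D) → N v = 0 := by
    intro s
    induction s using Finset.induction_on with
    | empty => exact fun v _ h2 => h v fun k => h2 k (Finset.notMem_empty k)
    | insert k s hk ih =>
      intro v h1 h2
      have h3 : ∀ x ∈ Submodule.span ℂ D, N (Function.update v k x) = 0 := by
        intro x hx
        induction hx using Submodule.span_induction with
        | mem x hx =>
          refine ih _ (fun j hj => ?_) fun j hj => ?_
          · rw [Function.update_of_ne (by rintro rfl; exact hk hj)]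
            exact h1 j (Finset.mem_insert_of_mem hj)
          · by_cases hjk : j = k
            · subst hjk
              rwa [Function.update_self]
            · rw [Function.update_of_ne hjk]
              exact h2 j fun h => (Finset.mem_insert.1 h).elim hjk hj
        | zero => exact N.map_update_zero _ _
        | add x y _ _ hx hy => rw [N.map_update_add, hx, hy, add_zero]
        | smul c x _ hx => rw [N.map_update_smul, hx, smul_zero]
      simpa using h3 (v k) (h1 k (Finset.mem_insert_self k s))
  exact key Finset.univ v (fun k _ => hv k) fun k hk => absurd (Finset.mem_univ k) hk

/-! ### Injectivity of `Ξ ↦ φ_Ξ` -/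

/-- The points of `H_Λ` with components outside of the finite set `S` equal to zero. -/
def finSuperspace (S : Finset (Idx ι₀ ι₁)) : Submodule ℂ (Idx ι₀ ι₁ → Grassmann) where
  carrier := {ζ | (∀ i, ζ i ∈ part (parity i)) ∧ ∀ i ∉ S, ζ i = 0}
  add_mem' := fun {ζ η} hζ hη => ⟨fun i => (part _).add_mem (hζ.1 i) (hη.1 i), fun i hi => by
    rw [Pi.add_apply, hζ.2 i hi, hη.2 i hi, add_zero]⟩
  zero_mem' := ⟨fun i => (part _).zero_mem, fun _ _ => rfl⟩
  smul_mem' := fun c ζ hζ => ⟨fun i => (part _).smul_mem c (hζ.1 i), fun i hi => by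
    rw [Pi.smul_apply, hζ.2 i hi, smul_zero]⟩

/-- The real points of `finSuperspace S`. -/
def finDiag (S : Finset (Idx ι₀ ι₁)) : Set (Idx ι₀ ι₁ → Grassmann) :=
  {ζ | ζ ∈ finSuperspace S ∧ vecStar ζ = ζ}

theorem vecStar_add (ζ η : Idx ι₀ ι₁ → Grassmann) : vecStar (ζ + η) = vecStar ζ + vecStar η :=
  funext fun _ => star_add _ _

theorem vecStar_sub (ζ η : Idx ι₀ ι₁ → Grassmann) : vecStar (ζ - η) = vecStar ζ - vecStar η :=
  funext fun _ => star_sub _ _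

theorem vecStar_smul (c : ℂ) (ζ : Idx ι₀ ι₁ → Grassmann) :
    vecStar (c • ζ) = star c • vecStar ζ :=
  funext fun i => star_smul c (ζ (conjIdx i))

theorem vecStar_vecStar (ζ : Idx ι₀ ι₁ → Grassmann) : vecStar (vecStar ζ) = ζ :=
  funext fun i => by rw [vecStar, vecStar, star_star, conjIdx_conjIdx]

theorem vecStar_sum {κ : Type*} (T : Finset κ) (v : κ → Idx ι₀ ι₁ → Grassmann) :
    vecStar (∑ k ∈ T, v k) = ∑ k ∈ T, vecStar (v k) :=
  map_sum (AddMonoidHom.mk' vecStar vecStar_add) v T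

theorem vecStar_mem_finSuperspace {S : Finset (Idx ι₀ ι₁)} (hS : ∀ i ∈ S, conjIdx i ∈ S)
    {ζ : Idx ι₀ ι₁ → Grassmann} (hζ : ζ ∈ finSuperspace S) : vecStar ζ ∈ finSuperspace S :=
  ⟨fun i => star_mem_part (hζ.1 (conjIdx i)), fun i hi => by
    rw [vecStar, hζ.2 _ fun h => hi (by simpa [conjIdx_conjIdx] using hS _ h), star_zero]⟩

theorem sum_mem_finDiag {S : Finset (Idx ι₀ ι₁)} {κ : Type*} {v : κ → Idx ι₀ ι₁ → Grassmann}
    (hv : ∀ k, v k ∈ finDiag S) (T : Finset κ) : ∑ k ∈ T, v k ∈ finDiag S :=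
  ⟨Submodule.sum_mem _ fun k _ => (hv k).1, by
    rw [vecStar_sum]
    exact Finset.sum_congr rfl fun k _ => (hv k).2⟩

/-- Decomposition into real and imaginary parts; closure of `S` under conjugation keeps `vecStar ζ`
supported in `S`. -/
theorem mem_span_finDiag {S : Finset (Idx ι₀ ι₁)} (hS : ∀ i ∈ S, conjIdx i ∈ S)
    {ζ : Idx ι₀ ι₁ → Grassmann} (hζ : ζ ∈ finSuperspace S) :
    ζ ∈ Submodule.span ℂ (finDiag S) := by
  have hζ' := vecStar_mem_finSuperspace hS hζ
  have h1 : ζ + vecStar ζ ∈ finDiag S :=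
    ⟨add_mem hζ hζ', by rw [vecStar_add, vecStar_vecStar, add_comm]⟩
  have h2 : Complex.I • (ζ - vecStar ζ) ∈ finDiag S :=
    ⟨Submodule.smul_mem _ _ (sub_mem hζ hζ'), by
      rw [vecStar_smul, vecStar_sub, vecStar_vecStar, RCLike.star_def, Complex.conj_I, neg_smul,
        ← smul_neg, neg_sub]⟩
  have h3 : ζ = (1 / 2 : ℂ) • (ζ + vecStar ζ) +
      (-Complex.I / 2) • (Complex.I • (ζ - vecStar ζ)) := by
    have h4 : -Complex.I / 2 * Complex.I = 1 / 2 := by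
      rw [div_mul_eq_mul_div, neg_mul, Complex.I_mul_I, neg_neg]
    rw [smul_smul, h4]
    module
  rw [h3]
  exact add_mem (Submodule.smul_mem _ _ (Submodule.subset_span h1))
    (Submodule.smul_mem _ _ (Submodule.subset_span h2))

theorem mem_diagSuperspace {S : Finset (Idx ι₀ ι₁)} {ζ : Idx ι₀ ι₁ → Grassmann}
    (hζ : ζ ∈ finDiag S) : ζ ∈ DiagSuperspace ι₀ ι₁ := by
  refine ⟨⟨?_, hζ.1.1⟩, hζ.2⟩
  rw [memℓp_two_iff]
  refine summable_of_ne_finset_zero (s := S) fun i hi => ?_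
  rw [hζ.1.2 i hi, norm_zero]
  norm_num

theorem ordProd_smul (c : ℂ) (ζ : Idx ι₀ ι₁ → Grassmann) {n : ℕ} (a : Fin n → Idx ι₀ ι₁) :
    ordProd (c • ζ) a = c ^ n • ordProd ζ a := by
  have h := (MultilinearMap.mkPiAlgebraFin ℂ n Grassmann).map_smul_univ (fun _ => c)
    (fun k => ζ (a k))
  simpa [ordProd] using h

theorem real_smul_mem_diagSuperspace (ζ : DiagSuperspace ι₀ ι₁) (t : ℝ) :
    (t : ℂ) • ζ.1 ∈ DiagSuperspace ι₀ ι₁ := by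
  refine ⟨⟨ζ.2.1.1.const_smul _, fun i => (part _).smul_mem _ (ζ.2.1.2 i)⟩, ?_⟩
  rw [vecStar_smul, ζ.2.2, RCLike.star_def, Complex.conj_ofReal]

/-- The homogeneous components of a function `φ_Ξ` that vanishes are zero. -/
theorem tsum_pairingTerm_eq_zero {Ξ : TensorFamily ι₀ ι₁} (hΞ : Ξ ∈ FockSpace ι₀ ι₁)
    (h : ∀ ζ, phi Ξ ζ = 0) (ζ : DiagSuperspace ι₀ ι₁) (n : ℕ) :
    ∑' a : Fin n → Idx ι₀ ι₁, pairingTerm (coherent ζ.1) Ξ ⟨n, a⟩ = 0 := by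
  refine eq_zero_of_hasSum_pow_smul (q := fun n =>
    ∑' a : Fin n → Idx ι₀ ι₁, pairingTerm (coherent ζ.1) Ξ ⟨n, a⟩) (fun t => ?_) n
  -- Only real scalars preserve `ζ* = ζ`, hence a power series in a real variable.
  let ζt : DiagSuperspace ι₀ ι₁ := ⟨(t : ℂ) • ζ.1, real_smul_mem_diagSuperspace ζ t⟩
  have hs := summable_pairingTerm (coherent_mem ζ).1 hΞ.1
  have hst := summable_pairingTerm (coherent_mem ζt).1 hΞ.1
  have h0 := hst.hasSum.sigma fun n => (hst.sigma_factor n).hasSum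
  have h1 : ∑' s, pairingTerm (coherent ζt.1) Ξ s = 0 := h ζt
  rw [h1] at h0
  refine h0.congr_fun fun m => ?_
  have h2 : ∀ a : Fin m → Idx ι₀ ι₁, pairingTerm (coherent ζt.1) Ξ ⟨m, a⟩ =
      ((t : ℂ) ^ m) • pairingTerm (coherent ζ.1) Ξ ⟨m, a⟩ := fun a => by
    simp only [pairingTerm]
    rw [coherent_apply ζt.2.1.2, coherent_apply ζ.2.1.2, ordProd_smul, smul_comm, smul_mul_assoc]
  simp only [h2]
  rw [(hs.sigma_factor m).tsum_const_smul, ← Complex.ofReal_pow, Complex.coe_smul]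

theorem gradedSign_dualIdx {n : ℕ} (σ : Equiv.Perm (Fin n)) (a : Fin n → Idx ι₀ ι₁) :
    gradedSign (Fin.revPerm * σ * Fin.revPerm) (dualIdx a) = gradedSign σ a := by
  rw [gradedSign, gradedSign]
  congr 1
  refine Finset.card_nbij' (fun p => (p.2.rev, p.1.rev)) (fun p => (p.2.rev, p.1.rev)) ?_ ?_ ?_ ?_
  · rintro ⟨p, q⟩ h
    simp only [dualIdx, parity_conjIdx, Finset.coe_filter, Finset.mem_univ, true_and,
      Set.mem_ofPred_eq, Equiv.Perm.mul_apply, Fin.revPerm_apply, Fin.rev_rev,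
      Fin.rev_lt_rev] at h ⊢
    exact ⟨h.1, h.2.1, h.2.2.2, h.2.2.1⟩
  · rintro ⟨p, q⟩ h
    simp only [dualIdx, parity_conjIdx, Finset.coe_filter, Finset.mem_univ, true_and,
      Set.mem_ofPred_eq, Equiv.Perm.mul_apply, Fin.revPerm_apply, Fin.rev_rev,
      Fin.rev_lt_rev] at h ⊢
    exact ⟨h.1, h.2.1, h.2.2.2, h.2.2.1⟩
  · intro p _
    simp
  · intro p _
    simp

/-- Reversal of positions turns `σ` into its conjugate by `Fin.revPerm`, which has the same
fermionic inversions up to relabelling. -/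
theorem gradedProj_dualIdx {n : ℕ} {F : (Fin n → Idx ι₀ ι₁) → Grassmann} (hF : gradedProj F = F) :
    gradedProj (fun b => F (dualIdx b)) = fun b => F (dualIdx b) := by
  funext b
  conv_rhs => rw [← hF]
  rw [gradedProj, gradedProj]
  congr 1
  let e : Equiv.Perm (Fin n) ≃ Equiv.Perm (Fin n) :=
    (Equiv.mulLeft Fin.revPerm).trans (Equiv.mulRight Fin.revPerm)
  refine Fintype.sum_equiv e _ _ fun σ => ?_
  have h : dualIdx b ∘ ⇑(e σ)⁻¹ = dualIdx (b ∘ ⇑σ⁻¹) := by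
    funext k
    have hr : (Fin.revPerm : Equiv.Perm (Fin n))⁻¹ = Fin.revPerm := rfl
    simp [e, dualIdx, mul_inv_rev, hr]
  rw [h]
  congr 1
  exact (gradedSign_dualIdx σ _).symm

/-- The `n`-linear form of a tensor family in degree `n`, on vectors supported by `S`. -/
def polarForm (S : Finset (Idx ι₀ ι₁)) {n : ℕ} (F : (Fin n → Idx ι₀ ι₁) → Grassmann) :
    MultilinearMap ℂ (fun _ : Fin n => Idx ι₀ ι₁ → Grassmann) Grassmann :=
  ∑ b ∈ Fintype.piFinset fun _ : Fin n => S,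
    (LinearMap.mulRight ℂ (F b)).compMultilinearMap
      ((MultilinearMap.mkPiAlgebraFin ℂ n Grassmann).compLinearMap fun k => LinearMap.proj (b k))

theorem polarForm_apply (S : Finset (Idx ι₀ ι₁)) {n : ℕ} (F : (Fin n → Idx ι₀ ι₁) → Grassmann)
    (v : Fin n → Idx ι₀ ι₁ → Grassmann) :
    polarForm S F v = ∑ b ∈ Fintype.piFinset fun _ : Fin n => S,
      (List.ofFn fun k => v k (b k)).prod * F b := by
  simp [polarForm]

theorem prod_ofFn_eq_zero {n : ℕ} {x : Fin n → Grassmann} {k : Fin n} (h : x k = 0) :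
    (List.ofFn x).prod = 0 :=
  (MultilinearMap.mkPiAlgebraFin ℂ n Grassmann).map_coord_zero k h

/-- For `ζ` supported in `S` the degree `n` component of `φ_Ξ` is a finite sum, a nonzero multiple
of the diagonal value of the form. -/
theorem polarForm_diag_eq_zero {Ξ : TensorFamily ι₀ ι₁} (hΞ : Ξ ∈ FockSpace ι₀ ι₁)
    (h : ∀ ζ, phi Ξ ζ = 0) (n : ℕ) {S : Finset (Idx ι₀ ι₁)} {ζ : Idx ι₀ ι₁ → Grassmann}
    (hζ : ζ ∈ finDiag S) :
    polarForm S (fun b : Fin n → Idx ι₀ ι₁ => Ξ n (dualIdx b)) (fun _ => ζ) = 0 := by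
  have h1 := tsum_pairingTerm_eq_zero hΞ h ⟨ζ, mem_diagSuperspace hζ⟩ n
  let e : (Fin n → Idx ι₀ ι₁) ≃ (Fin n → Idx ι₀ ι₁) :=
    Function.Involutive.toPerm dualIdx dualIdx_dualIdx
  have h2 : ∀ b : Fin n → Idx ι₀ ι₁, pairingTerm (coherent ζ) Ξ ⟨n, e b⟩ =
      (((Real.sqrt (n ! : ℝ))⁻¹ : ℝ) : ℂ) • (ordProd ζ b * Ξ n (dualIdx b)) := fun b => by
    have h3 : pairingTerm (coherent ζ) Ξ ⟨n, e b⟩ =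
        coherent ζ n (dualIdx (dualIdx b)) * Ξ n (dualIdx b) := rfl
    rw [h3, dualIdx_dualIdx, coherent_apply hζ.1.1, smul_mul_assoc]
  rw [← e.tsum_eq] at h1
  simp only [h2] at h1
  rw [tsum_eq_sum (s := Fintype.piFinset fun _ : Fin n => S), ← Finset.smul_sum] at h1
  · rw [polarForm_apply]
    refine (smul_eq_zero.1 h1).resolve_left ?_
    have h0 : (0 : ℝ) < n ! := by exact_mod_cast Nat.factorial_pos _
    exact Complex.ofReal_ne_zero.2 (inv_ne_zero (Real.sqrt_pos.2 h0).ne')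
  · intro b hb
    rw [Fintype.mem_piFinset] at hb
    push Not at hb
    obtain ⟨k, hk⟩ := hb
    rw [ordProd, prod_ofFn_eq_zero (hζ.1.2 _ hk), zero_mul, smul_zero]

theorem sum_perm_polarForm_eq_zero {Ξ : TensorFamily ι₀ ι₁} (hΞ : Ξ ∈ FockSpace ι₀ ι₁)
    (h : ∀ ζ, phi Ξ ζ = 0) (n : ℕ) {S : Finset (Idx ι₀ ι₁)} (hS : ∀ i ∈ S, conjIdx i ∈ S)
    (v : Fin n → Idx ι₀ ι₁ → Grassmann) (hv : ∀ k, v k ∈ finSuperspace S) :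
    ∑ σ : Equiv.Perm (Fin n),
      polarForm S (fun b : Fin n → Idx ι₀ ι₁ => Ξ n (dualIdx b)) (fun k => v (σ k)) = 0 := by
  set M := polarForm S (fun b : Fin n → Idx ι₀ ι₁ => Ξ n (dualIdx b))
  have h1 := multilinear_eq_zero_of_span (∑ σ : Equiv.Perm (Fin n), M.domDomCongr σ) (finDiag S)
    -- The span argument is applied to the symmetrized form, because polarization gives no vanishing
    -- of the form itself.
    (fun v hv => by
      rw [sum_apply]
      exact sum_perm_eq_zero_of_diag M v fun T =>
        polarForm_diag_eq_zero hΞ h n (sum_mem_finDiag hv T)) v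
    fun k => mem_span_finDiag hS (hv k)
  rwa [sum_apply] at h1

/-- Reordering the factors of a product of elements of the parities of `e_{d₁}, …, e_{dₙ}` brings
a symmetrized sum of the coefficients of a graded symmetric tensor back to one coefficient. -/
theorem sum_perm_prod_mul {n : ℕ} {F : (Fin n → Idx ι₀ ι₁) → Grassmann} (hF : gradedProj F = F)
    (d : Fin n → Idx ι₀ ι₁) (θ : Fin n → Grassmann) (hθ : ∀ k, θ k ∈ part (parity (d k))) :
    ∑ σ : Equiv.Perm (Fin n), (List.ofFn fun k => θ (σ k)).prod * F (fun k => d (σ k)) =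
      (n ! : ℂ) • ((List.ofFn θ).prod * F d) := by
  have h0 : (n ! : ℂ) ≠ 0 := by exact_mod_cast Nat.factorial_ne_zero _
  conv_rhs => rw [← hF]
  rw [gradedProj, mul_smul_comm, smul_smul, mul_inv_cancel₀ h0, one_smul, Finset.mul_sum]
  refine Fintype.sum_equiv (Equiv.inv _) _ _ fun σ => ?_
  have h := prod_ofFn_perm (fun k => parity (d k)) θ
    (fun _ _ => mul_eq_smul_mul (hθ _) (hθ _)) σ⁻¹
  rw [Equiv.inv_apply, gradedSign_comp_inv, mul_smul_comm, ← smul_mul_assoc, ← h, inv_inv]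
  rfl

theorem eq_zero_of_phi_eq_zero {Ξ : TensorFamily ι₀ ι₁} (hΞ : Ξ ∈ FockSpace ι₀ ι₁)
    (h : ∀ ζ, phi Ξ ζ = 0) (n : ℕ) (a : Fin n → Idx ι₀ ι₁) : Ξ n a = 0 := by
  classical
  refine ext_coeff fun A => ?_
  rw [coeff_zero]
  set d := dualIdx a with hd
  let S : Finset (Idx ι₀ ι₁) :=
    Finset.univ.image d ∪ Finset.univ.image fun k => conjIdx (d k)
  have hS : ∀ i ∈ S, conjIdx i ∈ S := by
    intro i hi
    simp only [S, Finset.mem_union, Finset.mem_image, Finset.mem_univ, true_and] at hi ⊢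
    rcases hi with ⟨k, rfl⟩ | ⟨k, rfl⟩
    · exact Or.inr ⟨k, rfl⟩
    · exact Or.inl ⟨k, (conjIdx_conjIdx _).symm⟩
  have hdS : ∀ k, d k ∈ S := fun k =>
    Finset.mem_union_left _ (Finset.mem_image_of_mem _ (Finset.mem_univ k))
  -- Each fermionic slot gets its own generator beyond every element of `A`; a bosonic slot gets
  -- `κ_∅ = 1`.
  let B : Fin n → Finset ℕ := fun k => if parity (d k) = 1 then {A.sup id + 1 + k} else ∅
  have hB1 : Pairwise fun j k => Disjoint (B j) (B k) := by
    intro j k hjk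
    have hne : (j : ℕ) ≠ k := fun h => hjk (Fin.ext h)
    simp only [B]
    split_ifs <;> simp [hne]
  have hB2 : ∀ k, Disjoint (B k) A := by
    intro k
    simp only [B]
    split_ifs
    · rw [Finset.disjoint_singleton_left]
      intro hk
      have := Finset.le_sup (f := id) hk
      simp only [id] at this
      omega
    · exact Finset.disjoint_empty_left _
  let θ : Fin n → Grassmann := fun k => kappa (B k)
  have hθ : ∀ k, θ k ∈ part (parity (d k)) := by
    intro k
    have h1 : ((B k).card : ZMod 2) = parity (d k) := by
      by_cases hk : parity (d k) = 1
      · simp [B, hk]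
      · have h2 : ∀ x : ZMod 2, x ≠ 1 → x = 0 := by decide
        simp [B, h2 _ hk]
    rw [← h1]
    exact kappa_mem_part _
  let v : Fin n → Idx ι₀ ι₁ → Grassmann := fun k => Pi.single (d k) (θ k)
  have hv : ∀ k, v k ∈ finSuperspace S := by
    refine fun k => ⟨fun i => ?_, fun i hi => ?_⟩
    · by_cases hi : i = d k
      · subst hi
        simpa [v] using hθ k
      · simp only [v, Pi.single_eq_of_ne hi]
        exact (part _).zero_mem
    · exact Pi.single_eq_of_ne (by rintro rfl; exact hi (hdS k)) _
  have h1 := sum_perm_polarForm_eq_zero hΞ h n hS v hv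
  -- Each test vector lives on one label, so only `b = d ∘ σ` survives. Repeated labels in `d` do no
  -- harm, since fermionic slots still carry distinct generators.
  have h2 : ∀ σ : Equiv.Perm (Fin n),
      polarForm S (fun b : Fin n → Idx ι₀ ι₁ => Ξ n (dualIdx b)) (fun k => v (σ k)) =
        (List.ofFn fun k => θ (σ k)).prod * Ξ n (dualIdx fun k => d (σ k)) := by
    intro σ
    rw [polarForm_apply, Finset.sum_eq_single_of_mem (fun k => d (σ k))
      (Fintype.mem_piFinset.2 fun k => hdS _)]
    · simp [v]
    · intro b _ hb
      obtain ⟨k, hk⟩ := Function.ne_iff.1 hb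
      rw [prod_ofFn_eq_zero (k := k) (Pi.single_eq_of_ne hk _), zero_mul]
  simp only [h2] at h1
  rw [sum_perm_prod_mul (F := fun b => Ξ n (dualIdx b)) (gradedProj_dualIdx (hΞ.2 n)) d θ hθ,
    hd, dualIdx_dualIdx] at h1
  have h0 : (n ! : ℂ) ≠ 0 := by exact_mod_cast Nat.factorial_ne_zero _
  exact coeff_eq_zero_of_prod_kappa_mul B A hB1 hB2 _ ((smul_eq_zero.1 h1).resolve_left h0)

/-! ### Well-definedness of the form on the function space -/

theorem sub_mem_fockSpace {Ξ Η : TensorFamily ι₀ ι₁} (hΞ : Ξ ∈ FockSpace ι₀ ι₁)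
    (hΗ : Η ∈ FockSpace ι₀ ι₁) : Ξ - Η ∈ FockSpace ι₀ ι₁ :=
  ⟨hΞ.1.sub hΗ.1, fun n => by rw [Pi.sub_apply, gradedProj_sub, hΞ.2, hΗ.2]⟩

theorem phi_injOn : Set.InjOn phi (FockSpace ι₀ ι₁) := by
  intro Ξ hΞ Η hΗ h
  have h1 : ∀ ζ, phi (Ξ - Η) ζ = 0 := fun ζ => by
    have h2 : phi Ξ ζ = phi Η ζ := congrFun h ζ
    rw [phi, phi, ← sub_eq_zero, pairing, pairing,
      ← (summable_pairingTerm (coherent_mem ζ).1 hΞ.1).tsum_sub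
        (summable_pairingTerm (coherent_mem ζ).1 hΗ.1)] at h2
    rw [phi, pairing, ← h2]
    exact tsum_congr fun s => mul_sub _ _ _
  funext n a
  exact sub_eq_zero.1 (eq_zero_of_phi_eq_zero (sub_mem_fockSpace hΞ hΗ) h1 n a)

theorem form_phi {Ξ Η : TensorFamily ι₀ ι₁} (hΞ : Ξ ∈ FockSpace ι₀ ι₁)
    (hΗ : Η ∈ FockSpace ι₀ ι₁) : form (phi Ξ) (phi Η) = sesq Ξ Η := by
  rw [form, symbol, symbol, phi_injOn.leftInvOn_invFunOn hΞ, phi_injOn.leftInvOn_invFunOn hΗ]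

end SuperFock

end

/-! ### The reproducing kernel -/

theorem mainTheorem5 {ι₀ ι₁ : Type*} [Countable ι₀] [Countable ι₁] :
    -- coherent states belong to the extended Fock space, and the form on it is given by a
    -- convergent series
    (∀ η : SuperFock.DiagSuperspace ι₀ ι₁, SuperFock.coherent η.1 ∈ SuperFock.FockSpace ι₀ ι₁) ∧
    (∀ Ξ ∈ SuperFock.FockSpace ι₀ ι₁, ∀ Η ∈ SuperFock.FockSpace ι₀ ι₁,
      Summable (SuperFock.pairingTerm Ξ Η) ∧
      Summable (SuperFock.pairingTerm (SuperFock.fockStar Ξ) Η)) ∧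
    -- the form on the function space is well defined
    Set.InjOn SuperFock.phi (SuperFock.FockSpace ι₀ ι₁) ∧
    (∀ Ξ ∈ SuperFock.FockSpace ι₀ ι₁, ∀ Η ∈ SuperFock.FockSpace ι₀ ι₁,
      SuperFock.form (SuperFock.phi Ξ) (SuperFock.phi Η) = SuperFock.sesq Ξ Η) ∧
    -- the kernel
    (∀ ζ₁ ζ₂ : SuperFock.DiagSuperspace ι₀ ι₁,
      SuperFock.kernel ζ₁ ζ₂ = NormedSpace.exp (SuperFock.vecSesq ζ₁.1 ζ₂.1) ∧
      SuperFock.kernel ζ₁ ζ₂ = NormedSpace.exp (SuperFock.vecPairing ζ₁.1 ζ₂.1) ∧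
      SuperFock.kernel ζ₁ ζ₂ ∈ SuperFock.Grassmann.part 0) ∧
    -- the reproducing property
    (∀ η : SuperFock.DiagSuperspace ι₀ ι₁,
      (fun ζ => SuperFock.kernel ζ η) ∈ SuperFock.FunSpace ι₀ ι₁) ∧
    (∀ φ ∈ SuperFock.FunSpace ι₀ ι₁, ∀ η : SuperFock.DiagSuperspace ι₀ ι₁,
      SuperFock.form (fun ζ => SuperFock.kernel ζ η) φ = φ η) := by
  have hK : ∀ η : SuperFock.DiagSuperspace ι₀ ι₁,
      (fun ζ => SuperFock.kernel ζ η) = SuperFock.phi (SuperFock.coherent η.1) := fun η =>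
    funext fun ζ => SuperFock.kernel_eq_phi ζ η
  refine ⟨SuperFock.coherent_mem, fun Ξ hΞ Η hΗ => ⟨SuperFock.summable_pairingTerm hΞ.1 hΗ.1,
    SuperFock.summable_pairingTerm (SuperFock.memℓp_fockStar hΞ.1) hΗ.1⟩, SuperFock.phi_injOn,
    fun Ξ hΞ Η hΗ => SuperFock.form_phi hΞ hΗ, fun ζ₁ ζ₂ => ⟨?_, SuperFock.kernel_eq_exp ζ₁ ζ₂,
      SuperFock.kernel_mem_part_zero ζ₁ ζ₂⟩, fun η => ?_, ?_⟩
  · rw [SuperFock.vecSesq_eq, SuperFock.kernel_eq_exp]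
  · rw [hK]
    exact ⟨_, SuperFock.coherent_mem η, rfl⟩
  · rintro _ ⟨Ξ, hΞ, rfl⟩ η
    rw [hK, SuperFock.form_phi (SuperFock.coherent_mem η) hΞ, SuperFock.sesq,
      SuperFock.fockStar_coherent, SuperFock.phi]
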